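/- Let $\sigma$ be a positive measure on $[0,2\pi]$ with infinite support, normalized by $\frac1{2\pi}\int_0^{2\pi}d\sigma=1$, and let $c_k=\frac1{2\pi}\int_0^{2\pi}e^{-ik\varphi}\,d\sigma(\varphi)$, $k\in\mathbb Z$. For a polynomial $P$ of degree $N$ put $P^*(z)=z^N\overline{P}(1/z)$, where $\overline P$ has the complex conjugate coefficients. Let $\Phi_k(z)=z^k+\dots$ be the monic polynomials orthogonal with respect to $\sigma$, i.e. $\int_0^{2\pi}e^{-ij\varphi}\Phi_k(e^{i\varphi})\,d\sigma(\varphi)=0$ for $0\le j<k$, and let $a_j$ be their recurrence coefficients, $\Phi_{j+1}(z)=z\Phi_j(z)-a_j\Phi_j^*(z)$. Put $\mathbb D=\{|z|<1\}$, $\mathbb T=\{|z|=1\}$. Let $n\ge 1$, $0\le m\le n-1$ and let $0\le\varphi_1<\varphi_2<\dots<\varphi_n<2\pi$. Then the following four statements are equivalent. (a) There are $\mu_1,\dots,\mu_n>0$ such that $$\frac1{2\pi}\int_0^{2\pi}e^{-ik\varphi}\,d\sigma(\varphi)=\sum_{s=1}^n\mu_s e^{-ik\varphi_s}\qquad\text{for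 } k=0,\pm1,\dots,\pm(n-m-1).$$ (b) There are $\tilde a_0,\dots,\tilde a_{n-2}\in\mathbb C$ with $|\tilde a_j|<1$ for $j=0,\dots,n-2$ and $\tilde a_j=a_j$ for $j=0,\dots,n-m-2$, and an $\eta\in\mathbb T$, such that the polynomial $\tilde\Phi_{n-1}$ generated by $\tilde\Phi_0=1$, $\tilde\Phi_j(z)=z\tilde\Phi_{j-1}(z)-\tilde a_{j-1}\tilde\Phi_{j-1}^*(z)$ satisfies $$z\tilde\Phi_{n-1}(z)+\eta\tilde\Phi_{n-1}^*(z)=\prod_{s=1}^n(z-e^{i\varphi_s}).$$ (c) There are a monic polynomial $q_m$ of degree $m$ which has all its zeros in $\mathbb D$ and an $\eta\in\mathbb T$ such that $$z\,q_m(z)\Phi_{n-m-1}(z)+\eta\,q_m^*(z)\Phi_{n-m-1}^*(z)=\prod_{s=1}^n(z-e^{i\varphi_s}).$$ (d) There are a monic polynomial $p_{n-1}$ of degree $n-1$ which has all its zeros in $\mathbb D$ and an $\eta\in\mathbb T$ such that $$z\,p_{n-1}(z)+\eta\,p_{n-1}^*(z)=\prod_{s=1}^n(z-e^{i\varphi_s})$$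 and, as $z\to0$, $$\frac{\eta p_{n-1}^*(z)-z p_{n-1}(z)}{\eta p_{n-1}^*(z)+z p_{n-1}(z)}=1+2\sum_{k=1}^{n-m-1}c_kz^k+O(z^{n-m}).$$ -/

import Mathlib

open MeasureTheory Polynomial

noncomputable section

namespace PositiveQF

/-- The point `e^{iφ}` of the unit circle. -/
def expI (φ : ℝ) : ℂ := Complex.exp (Complex.I * φ)

/-- The trigonometric moment `c_k = (1/2π) ∫_0^{2π} e^{-ikφ} dσ(φ)`, for every integer `k`. -/
def moment (σ : Measure ℝ) (k : ℤ) : ℂ :=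
  1 / (2 * (Real.pi : ℂ)) *
    ∫ φ in Set.Icc (0 : ℝ) (2 * Real.pi), Complex.exp (-(Complex.I * k * φ)) ∂σ

/-- The pairing `∫_0^{2π} conj(p(e^{iφ})) q(e^{iφ}) dσ(φ)` of two polynomials. -/
def pairing (σ : Measure ℝ) (p q : ℂ[X]) : ℂ :=
  ∫ φ in Set.Icc (0 : ℝ) (2 * Real.pi),
    (starRingEnd ℂ) (p.eval (expI φ)) * q.eval (expI φ) ∂σ

/-- The reversed polynomial `p^*(z) = z^N conj(p)(1/z)`, for `p` of degree `N`
(`conj(p)` has the conjugate coefficients). -/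
def star (N : ℕ) (p : ℂ[X]) : ℂ[X] := (p.map (starRingEnd ℂ)).reflect N

/-- The monic orthogonal polynomial `Φ_n` of degree `n` with respect to `σ`, obtained by
orthogonalizing `1, z, z², …`. -/
def Phi (σ : Measure ℝ) (n : ℕ) : ℂ[X] :=
  X ^ n - ∑ k : Fin n,
    C (pairing σ (Phi σ k) (X ^ n) / pairing σ (Phi σ k) (Phi σ k)) * Phi σ k
termination_by n
decreasing_by all_goals exact k.2

/-- The recurrence coefficients `a_j` in `Φ_{j+1} = z Φ_j - a_j Φ_j^*`; as `Φ_j^*(0) = 1`, this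
relation says at `z = 0` that `a_j = -Φ_{j+1}(0)`. -/
def recCoeff (σ : Measure ℝ) (j : ℕ) : ℂ := -(Phi σ (j + 1)).eval 0

/-- The polynomials generated by the recurrence `P_{j+1} = z P_j - a_j P_j^*` from `P_0 = 1`. -/
def szegoRec (a : ℕ → ℂ) : ℕ → ℂ[X]
  | 0 => 1
  | j + 1 => X * szegoRec a j - C (a j) * star j (szegoRec a j)

/-- The nodes polynomial `∏_s (z - e^{iφ_s})`. -/
def nodePoly {n : ℕ} (φ : Fin n → ℝ) : ℂ[X] := ∏ s, (X - C (expI (φ s)))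

/-- All zeros of `p` lie in the open unit disc. -/
def ZerosInDisc (p : ℂ[X]) : Prop := ∀ z : ℂ, p.IsRoot z → ‖z‖ < 1


variable {σ : Measure ℝ}

lemma continuous_evalExpI (p : ℂ[X]) : Continuous fun φ : ℝ => p.eval (expI φ) := by
  unfold expI
  have := p.continuous
  fun_prop

lemma integrable_pairing (hfin : σ (Set.Icc (0 : ℝ) (2 * Real.pi)) ≠ ⊤) (p q : ℂ[X]) :
    IntegrableOn (fun φ : ℝ => (starRingEnd ℂ) (p.eval (expI φ)) * q.eval (expI φ))
      (Set.Icc (0 : ℝ) (2 * Real.pi)) σ := by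
  have hc : Continuous fun φ : ℝ => (starRingEnd ℂ) (p.eval (expI φ)) * q.eval (expI φ) :=
    (Complex.continuous_conj.comp (continuous_evalExpI p)).mul (continuous_evalExpI q)
  obtain ⟨M, hM⟩ := (isCompact_Icc (a := (0 : ℝ)) (b := 2 * Real.pi)).exists_bound_of_continuousOn
    hc.continuousOn
  exact Measure.integrableOn_of_bounded (M := M) hfin hc.aestronglyMeasurable
    ((ae_restrict_iff' measurableSet_Icc).2 (Filter.Eventually.of_forall hM))

lemma expI_zeros_finite {p : ℂ[X]} (hp : p ≠ 0) :
    ({φ : ℝ | p.eval (expI φ) = 0} ∩ Set.Icc (0 : ℝ) (2 * Real.pi)).Finite := by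
  have h1 : ({φ : ℝ | p.eval (expI φ) = 0} ∩ Set.Ico (0 : ℝ) (2 * Real.pi)).Finite := by
    refine Set.Finite.of_finite_image (f := expI)
      ((p.roots.toFinset.finite_toSet).subset ?_) ?_
    · rintro _ ⟨φ, ⟨h, -⟩, rfl⟩
      simpa [hp] using h
    · rintro x ⟨-, hx⟩ y ⟨-, hy⟩ hxy
      unfold expI at hxy
      obtain ⟨k, hk⟩ := Complex.exp_eq_exp_iff_exists_int.1 hxy
      have hk' : x = y + k * (2 * Real.pi) := by
        have : Complex.I * (x : ℂ) = Complex.I * ((y + k * (2 * Real.pi) : ℝ) : ℂ) := by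
          rw [hk]; push_cast; ring
        exact_mod_cast mul_left_cancel₀ Complex.I_ne_zero this
      have hpi := Real.pi_pos
      have h3 : (k : ℝ) < 1 := by
        by_contra h; nlinarith [hx.1, hx.2, hy.1, hy.2]
      have h4 : (-1 : ℝ) < k := by
        by_contra h; nlinarith [hx.1, hx.2, hy.1, hy.2]
      have : k = 0 := by
        have a : k < 1 := by exact_mod_cast h3
        have b : -1 < k := by exact_mod_cast h4
        omega
      simpa [this] using hk'
  refine (h1.union (Set.finite_singleton (2 * Real.pi))).subset ?_
  rintro x ⟨hx, hx0, hx1⟩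
  rcases hx1.lt_or_eq with h | h
  · exact Or.inl ⟨hx, hx0, h⟩
  · exact Or.inr h

lemma pairing_self_ne_zero (hconc : σ (Set.Icc (0 : ℝ) (2 * Real.pi))ᶜ = 0)
    (hfin : σ (Set.Icc (0 : ℝ) (2 * Real.pi)) ≠ ⊤) (hinf : σ.support.Infinite)
    {p : ℂ[X]} (hp : p ≠ 0) : pairing σ p p ≠ 0 := by
  intro h
  have hI := integrable_pairing hfin p p
  have he : ∀ φ : ℝ, (starRingEnd ℂ) (p.eval (expI φ)) * p.eval (expI φ)
      = ((‖p.eval (expI φ)‖ ^ 2 : ℝ) : ℂ) := by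
    intro φ
    rw [mul_comm, Complex.mul_conj, Complex.normSq_eq_norm_sq]
  unfold pairing at h
  simp only [he] at h hI
  rw [integral_complex_ofReal] at h
  have h0 : ∫ φ in Set.Icc (0 : ℝ) (2 * Real.pi), ‖p.eval (expI φ)‖ ^ 2 ∂σ = 0 := by
    exact_mod_cast h
  have hI' : IntegrableOn (fun φ : ℝ => ‖p.eval (expI φ)‖ ^ 2)
      (Set.Icc (0 : ℝ) (2 * Real.pi)) σ := by
    refine hI.re.congr (Filter.Eventually.of_forall fun φ => ?_)
    exact Complex.ofReal_re _
  rw [setIntegral_eq_zero_iff_of_nonneg_ae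
    (Filter.Eventually.of_forall fun φ => by positivity) hI'] at h0
  have h1 := (ae_restrict_iff' measurableSet_Icc).1 h0
  set Z := {φ : ℝ | p.eval (expI φ) = 0} ∩ Set.Icc (0 : ℝ) (2 * Real.pi) with hZ
  have hZf : Z.Finite := expI_zeros_finite hp
  have hae : Z ∈ ae σ := by
    have h2 : ∀ᵐ φ ∂σ, φ ∈ Set.Icc (0 : ℝ) (2 * Real.pi) := hconc
    filter_upwards [h1, h2] with φ a b
    exact ⟨by simpa using a b, b⟩
  exact hinf (hZf.subset (Measure.support_subset_of_isClosed hZf.isClosed hae))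

lemma pairing_sub_sum (hfin : σ (Set.Icc (0 : ℝ) (2 * Real.pi)) ≠ ⊤) {ι : Type*} (s : Finset ι)
    (p q : ℂ[X]) (c : ι → ℂ) (f : ι → ℂ[X]) :
    pairing σ p (q - ∑ k ∈ s, C (c k) * f k)
      = pairing σ p q - ∑ k ∈ s, c k * pairing σ p (f k) := by
  unfold pairing
  simp only [← integral_const_mul]
  rw [← integral_finsetSum _ fun k _ => (integrable_pairing hfin p (f k)).const_mul (c k),
    ← integral_sub (integrable_pairing hfin p q)
      (integrable_finsetSum _ fun k _ => (integrable_pairing hfin p (f k)).const_mul (c k))]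
  congr 1
  ext φ
  simp only [eval_sub, eval_finsetSum, eval_mul, eval_C, mul_sub, Finset.mul_sum]
  congr 1
  exact Finset.sum_congr rfl fun k _ => by ring

lemma pairing_conj (p q : ℂ[X]) : (starRingEnd ℂ) (pairing σ p q) = pairing σ q p := by
  unfold pairing
  rw [← integral_conj]
  congr 1
  ext φ
  simp [mul_comm]

lemma Phi_eq (σ : Measure ℝ) (n : ℕ) : Phi σ n = X ^ n - ∑ k ∈ Finset.range n,
    C (pairing σ (Phi σ k) (X ^ n) / pairing σ (Phi σ k) (Phi σ k)) * Phi σ k := by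
  rw [Phi, Finset.sum_range]

lemma Phi_monic_natDegree (σ : Measure ℝ) (n : ℕ) :
    (Phi σ n).Monic ∧ (Phi σ n).natDegree = n := by
  induction n using Nat.strong_induction_on with
  | _ n ih =>
    have hd : (∑ k ∈ Finset.range n,
        C (pairing σ (Phi σ k) (X ^ n) / pairing σ (Phi σ k) (Phi σ k)) * Phi σ k).degree
          < (n : WithBot ℕ) := by
      refine (degree_sum_le _ _).trans_lt ((Finset.sup_lt_iff (WithBot.bot_lt_coe n)).2 ?_)
      intro k hk
      have hk' := Finset.mem_range.1 hk
      rw [← smul_eq_C_mul]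
      refine (degree_smul_le _ _).trans_lt ?_
      rw [degree_eq_natDegree (ih k hk').1.ne_zero, (ih k hk').2]
      exact Nat.cast_lt.2 hk'
    rw [Phi_eq]
    refine ⟨monic_X_pow_sub hd, ?_⟩
    exact natDegree_eq_of_degree_eq_some
      ((degree_sub_eq_left_of_degree_lt (by simpa using hd)).trans (degree_X_pow n))

lemma pairing_Phi_Phi (hconc : σ (Set.Icc (0 : ℝ) (2 * Real.pi))ᶜ = 0)
    (hfin : σ (Set.Icc (0 : ℝ) (2 * Real.pi)) ≠ ⊤) (hinf : σ.support.Infinite) (n : ℕ) :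
    ∀ j < n, pairing σ (Phi σ j) (Phi σ n) = 0 := by
  induction n using Nat.strong_induction_on with
  | _ n ih =>
    intro j hj
    have h0 := pairing_self_ne_zero hconc hfin hinf (Phi_monic_natDegree σ j).1.ne_zero
    rw [Phi_eq σ n, pairing_sub_sum hfin, Finset.sum_eq_single j]
    · rw [div_mul_cancel₀ _ h0, sub_self]
    · intro k hk hkj
      have hk' := Finset.mem_range.1 hk
      rcases lt_or_gt_of_ne hkj with h | h
      · rw [← pairing_conj (Phi σ k) (Phi σ j), ih j hj k h, map_zero, mul_zero]
      · rw [ih k hk' j h, mul_zero]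
    · intro h
      exact absurd (Finset.mem_range.2 hj) h

/-- `Phi σ n` is monic of degree `n` and `∫_0^{2π} e^{-ikφ} Φ_n(e^{iφ}) dσ(φ) = 0` for
`k = 0, …, n - 1`. -/
theorem Phi_spec (hconc : σ (Set.Icc (0 : ℝ) (2 * Real.pi))ᶜ = 0)
    (hfin : σ (Set.Icc (0 : ℝ) (2 * Real.pi)) ≠ ⊤) (hinf : σ.support.Infinite) (n : ℕ) :
    (Phi σ n).Monic ∧ (Phi σ n).natDegree = n ∧
      ∀ k < n, ∫ φ in Set.Icc (0 : ℝ) (2 * Real.pi),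
        Complex.exp (-(Complex.I * k * φ)) * (Phi σ n).eval (expI φ) ∂σ = 0 := by
  refine ⟨(Phi_monic_natDegree σ n).1, (Phi_monic_natDegree σ n).2, fun k hk => ?_⟩
  have h1 : pairing σ (Phi σ n) (X ^ k) = 0 := by
    have h2 : X ^ k = Phi σ k - ∑ j ∈ Finset.range k,
        C (-(pairing σ (Phi σ j) (X ^ k) / pairing σ (Phi σ j) (Phi σ j))) * Phi σ j := by
      conv_rhs => rw [Phi_eq σ k]
      simp only [C_neg, neg_mul, Finset.sum_neg_distrib]
      ring
    rw [h2, pairing_sub_sum hfin, ← pairing_conj,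
      pairing_Phi_Phi hconc hfin hinf n k hk, map_zero, zero_sub, neg_eq_zero]
    refine Finset.sum_eq_zero fun j hj => ?_
    rw [← pairing_conj (Phi σ j) (Phi σ n), pairing_Phi_Phi hconc hfin hinf n j
      ((Finset.mem_range.1 hj).trans hk), map_zero, mul_zero]
  have h2 : pairing σ (X ^ k) (Phi σ n) = 0 := by rw [← pairing_conj, h1, map_zero]
  rw [← h2]
  unfold pairing
  congr 1
  ext φ
  congr 1
  simp only [eval_pow, eval_X, map_pow, expI]
  rw [← Complex.exp_conj, ← Complex.exp_nat_mul]
  congr 1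
  simp
  ring

end PositiveQF

end

noncomputable section

namespace PositiveQF

-- Write `W` for the node polynomial, `w_s` for the nodes and `N = n - 1`. Statement (b) is tied to
-- (a) and to (c), and (d) to (a).
--
-- (a) ⇔ (b). A quadrature formula compares `σ` with an `n`-point measure, so both are treated as
-- instances of one `CircleForm`. Recurrence coefficients of order below `l` depend only on moments
-- of order at most `l`, and positivity puts them in the disc. `W` vanishes at every node, hence is
-- orthogonal to everything; this forces `W = zΦ_N + ηΦ_N^*` (`exists_X_mul_poly_add_star`).
-- Conversely, by Christoffel–Darboux the kernel at a node is a multiple of the cofactor of that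
-- node, so it vanishes at the other nodes. The values `Φ_j(w_s)` then form, up to scaling, a
-- unitary matrix, and the weights `1/K(w_s, w_s)` make `Φ_1, …, Φ_N` orthogonal to `1`
-- (`exists_weights`). This fixes the moments.
--
-- (b) ⇔ (c). `zΦ_N + ηΦ_N^*` can be built from either end of the coefficient sequence
-- (`X_mul_szegoRec_add_star`). The reversed tail generates `q`, and by the Schur–Cohn argument
-- monic polynomials with zeros in the disc are exactly those generated by coefficients in the disc.
--
-- (a) ⇔ (d). Take `p = ∑ μ_s W/(z - w_s)`. The quotient in (d) is `(W - 2zp)/W = ∑ μ_s (w_s +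
-- z)/(w_s - z)`, whose Taylor coefficients are twice the moments of the discrete measure. Such `p`
-- has its zeros in the disc by a real-part estimate; conversely, the kernel identity shows that
-- every admissible `p` has this form with positive weights (`exists_eq_weightedSum`).

local notation "conj" => starRingEnd ℂ

/-! ### Algebra of the reversal operation -/

section Star

lemma star_star (N : ℕ) (p : ℂ[X]) : star N (star N p) = p := by
  ext i
  simp [star, coeff_reflect]

lemma star_add (N : ℕ) (p q : ℂ[X]) : star N (p + q) = star N p + star N q := by
  simp [star, reflect_add]

lemma star_C_mul (N : ℕ) (c : ℂ) (p : ℂ[X]) : star N (C c * p) = C (conj c) * star N p := by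
  simp [star, reflect_C_mul]

lemma star_sub (N : ℕ) (p q : ℂ[X]) : star N (p - q) = star N p - star N q := by
  ext i
  simp [star, coeff_reflect]

lemma star_mul {M N : ℕ} {p q : ℂ[X]} (hp : p.natDegree ≤ M) (hq : q.natDegree ≤ N) :
    star (M + N) (p * q) = star M p * star N q := by
  unfold star
  rw [Polynomial.map_mul, reflect_mul _ _ (natDegree_map_le.trans hp) (natDegree_map_le.trans hq)]

lemma natDegree_star_le {N : ℕ} {p : ℂ[X]} (hp : p.natDegree ≤ N) :
    (star N p).natDegree ≤ N := by
  refine natDegree_reflect_le.trans (max_le le_rfl (natDegree_map_le.trans hp))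

lemma star_X_pow {N k : ℕ} (hk : k ≤ N) : star N (X ^ k) = X ^ (N - k) := by
  simp [star, reflect_monomial, revAt_le hk]

lemma star_succ_X_mul {N : ℕ} {p : ℂ[X]} (hp : p.natDegree ≤ N) :
    star (N + 1) (X * p) = star N p := by
  rw [add_comm, star_mul natDegree_X_le hp]
  simp [star]

lemma star_succ {N : ℕ} {p : ℂ[X]} (hp : p.natDegree ≤ N) :
    star (N + 1) p = X * star N p := by
  have := star_mul (M := 1) (p := 1) (by simp) hp
  rw [one_mul, add_comm] at this
  rw [this]
  simp [star]

lemma eval_star {N : ℕ} {p : ℂ[X]} (hp : p.natDegree ≤ N) {z : ℂ} (hz : ‖z‖ = 1) :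
    (star N p).eval z = z ^ N * conj (p.eval z) := by
  have hz0 : z ≠ 0 := by rintro rfl; simp at hz
  have hc : conj z = z⁻¹ := by rw [Complex.inv_def, Complex.normSq_eq_norm_sq, hz]; simp
  let _ : Invertible z⁻¹ := invertibleOfNonzero (inv_ne_zero hz0)
  have h := eval₂_reflect_mul_pow (RingHom.id ℂ) z⁻¹ N (p.map conj) (natDegree_map_le.trans hp)
  rw [invOf_eq_inv, inv_inv, eval₂_id, eval₂_id] at h
  rw [← eval_map_apply, hc, ← h]
  simp only [star]
  rw [mul_comm (z ^ N), mul_assoc, ← mul_pow, inv_mul_cancel₀ hz0, one_pow, mul_one]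

lemma eval_zero_star {N : ℕ} {p : ℂ[X]} (hp : p.Monic) (hN : p.natDegree = N) :
    (star N p).eval 0 = 1 := by
  rw [← coeff_zero_eq_eval_zero, star, coeff_reflect, revAt_zero, coeff_map, ← hN,
    coeff_natDegree, hp.leadingCoeff, map_one]

end Star

/-! ### The Szegő recurrence and its two-ended form -/

section SzegoRec

lemma szegoRec_monic_natDegree (a : ℕ → ℂ) (j : ℕ) :
    (szegoRec a j).Monic ∧ (szegoRec a j).natDegree = j := by
  induction j with
  | zero => simp [szegoRec]
  | succ j ih =>
    have h1 : (X * szegoRec a j).Monic := monic_X.mul ih.1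
    have h2 : (X * szegoRec a j).natDegree = j + 1 := by
      rw [monic_X.natDegree_mul ih.1, natDegree_X, ih.2, add_comm]
    have h3 : (C (a j) * star j (szegoRec a j)).natDegree < (X * szegoRec a j).natDegree := by
      rw [h2]
      exact Nat.lt_succ_of_le ((natDegree_C_mul_le _ _).trans (natDegree_star_le ih.2.le))
    exact ⟨h1.sub_of_left (degree_lt_degree h3), by
      rw [szegoRec, natDegree_sub_eq_left_of_natDegree_lt h3, h2]⟩

lemma szegoRec_monic (a : ℕ → ℂ) (j : ℕ) : (szegoRec a j).Monic :=
  (szegoRec_monic_natDegree a j).1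

lemma natDegree_szegoRec (a : ℕ → ℂ) (j : ℕ) : (szegoRec a j).natDegree = j :=
  (szegoRec_monic_natDegree a j).2

lemma star_szegoRec_succ (a : ℕ → ℂ) (j : ℕ) :
    star (j + 1) (szegoRec a (j + 1))
      = star j (szegoRec a j) - C (conj (a j)) * (X * szegoRec a j) := by
  have h := (natDegree_szegoRec a j).le
  rw [szegoRec, star_sub, star_C_mul, star_succ_X_mul h, star_succ (natDegree_star_le h), star_star]

lemma szegoRec_congr {a b : ℕ → ℂ} {N : ℕ} (h : ∀ j < N, a j = b j) :
    szegoRec a N = szegoRec b N := by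
  induction N with
  | zero => rfl
  | succ N ih => rw [szegoRec, szegoRec, ih fun j hj => h j (by omega), h N (by omega)]

/-- Running the recurrence from both ends: the coefficients of `q` are those of the tail of `a`,
reversed, conjugated and rotated by `η`. -/
lemma X_mul_szegoRec_add_star (a b : ℕ → ℂ) {η : ℂ} (hη : ‖η‖ = 1) (k m : ℕ)
    (hb : ∀ i < m, b i = η * conj (a (k + m - 1 - i))) :
    X * szegoRec a (k + m) + C η * star (k + m) (szegoRec a (k + m))
      = X * szegoRec b m * szegoRec a k
        + C η * star m (szegoRec b m) * star k (szegoRec a k) := by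
  have hη' : (C η : ℂ[X]) * C (conj η) = 1 := by
    rw [← C_mul, Complex.mul_conj, Complex.normSq_eq_norm_sq, hη]; simp
  induction m generalizing k with
  | zero => simp [szegoRec, star]
  | succ m ih =>
    -- The tail is shortened at its front: `a k` is read last in the reversed order, so it is the
    -- coefficient `b m`.
    have h1 := ih (k + 1) (fun i hi => by rw [hb i (by omega)]; congr 3; omega)
    rw [show k + 1 + m = k + (m + 1) by ring] at h1
    have h2 : b m = η * conj (a k) := by rw [hb m (by omega)]; congr 3; omega
    rw [h1, star_szegoRec_succ, star_szegoRec_succ, szegoRec, szegoRec, h2]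
    simp only [map_mul, Complex.conj_conj]
    linear_combination (C (a k) * X * szegoRec b m * star k (szegoRec a k)) * hη'

end SzegoRec

/-! ### Zeros in the disc and coefficients in the disc -/

section SchurCohn

/-- The invariance behind disc automorphisms; it controls both a recurrence step and a single
Blaschke factor. -/
lemma norm_sub_mul_sq_sub (a u v : ℂ) :
    ‖u - a * v‖ ^ 2 - ‖v - conj a * u‖ ^ 2 = (1 - ‖a‖ ^ 2) * (‖u‖ ^ 2 - ‖v‖ ^ 2) := by
  simp only [← Complex.normSq_eq_norm_sq, Complex.normSq_apply, Complex.sub_re, Complex.sub_im,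
    Complex.mul_re, Complex.mul_im, Complex.conj_re, Complex.conj_im]
  ring

/-- The two claims need a joint induction: `Φ_{N+1}(z) = 0` would give `|zΦ_N| = |a_N| |Φ_N^*|`,
which the bound for `N` excludes. -/
lemma norm_eval_star_szegoRec_le {a : ℕ → ℂ} {N : ℕ} (ha : ∀ j < N, ‖a j‖ < 1) {z : ℂ}
    (hz : 1 ≤ ‖z‖) :
    (szegoRec a N).eval z ≠ 0 ∧
      ‖(star N (szegoRec a N)).eval z‖ ≤ ‖(szegoRec a N).eval z‖ := by
  induction N with
  | zero => simp [szegoRec, star]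
  | succ N ih =>
    obtain ⟨h0, h1⟩ := ih fun j hj => ha j (by omega)
    have haN := ha N (by omega)
    rw [star_szegoRec_succ, szegoRec]
    simp only [eval_sub, eval_mul, eval_X, eval_C]
    set u := (szegoRec a N).eval z
    set v := (star N (szegoRec a N)).eval z
    have hu : 0 < ‖u‖ := norm_pos_iff.2 h0
    have hzu : ‖u‖ ≤ ‖z * u‖ := by rw [norm_mul]; nlinarith
    constructor
    · intro h
      have h2 : ‖z * u‖ = ‖a N‖ * ‖v‖ := by rw [sub_eq_zero.1 h, norm_mul]
      nlinarith [norm_nonneg (a N)]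
    · have h3 := norm_sub_mul_sq_sub (a N) (z * u) v
      have h4 : 0 ≤ (1 - ‖a N‖ ^ 2) * (‖z * u‖ ^ 2 - ‖v‖ ^ 2) := by
        refine mul_nonneg ?_ ?_
        · nlinarith [norm_nonneg (a N)]
        · nlinarith [norm_nonneg v]
      exact le_of_sq_le_sq (by linarith) (norm_nonneg _)

lemma zerosInDisc_szegoRec {a : ℕ → ℂ} {N : ℕ} (ha : ∀ j < N, ‖a j‖ < 1) :
    ZerosInDisc (szegoRec a N) := fun _ hz =>
  not_le.1 fun h => (norm_eval_star_szegoRec_le ha h).1 hz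

/-- Factor over the roots: each root `α` contributes `|1 - conj α z| ≤ |z - α|` outside the disc. -/
lemma norm_eval_star_le {q : ℂ[X]} (hq : q.Monic) (hz : ZerosInDisc q) {z : ℂ} (h : 1 ≤ ‖z‖) :
    ‖(star q.natDegree q).eval z‖ ≤ ‖q.eval z‖ := by
  have key : ∀ s : Multiset ℂ, (∀ α ∈ s, ‖α‖ < 1) →
      ‖(star s.card (s.map fun α => X - C α).prod).eval z‖
        ≤ ‖((s.map fun α => X - C α).prod).eval z‖ := by
    intro s
    induction s using Multiset.induction with
    | empty => simp [star]
    | cons α s ih =>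
      intro hs
      have h1 := ih fun β hβ => hs β (Multiset.mem_cons_of_mem hβ)
      have hα := hs α (Multiset.mem_cons_self α s)
      have h2 : star 1 (X - C α) = 1 - C (conj α) * X := by
        rw [star_sub]; simp [star, reflect_C]
      rw [Multiset.map_cons, Multiset.prod_cons, Multiset.card_cons, add_comm,
        star_mul (natDegree_X_sub_C_le _) (by rw [natDegree_multiset_prod_X_sub_C_eq_card]), h2,
        eval_mul, eval_mul, norm_mul, norm_mul]
      refine mul_le_mul ?_ h1 (norm_nonneg _) (norm_nonneg _)
      have h3 := norm_sub_mul_sq_sub α z 1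
      simp only [eval_sub, eval_one, eval_mul, eval_C, eval_X]
      rw [mul_one] at h3
      refine le_of_sq_le_sq ?_ (norm_nonneg _)
      have : 0 ≤ (1 - ‖α‖ ^ 2) * (‖z‖ ^ 2 - ‖(1 : ℂ)‖ ^ 2) := by
        rw [norm_one]
        exact mul_nonneg (by nlinarith [norm_nonneg α]) (by nlinarith)
      linarith
  have hs := IsAlgClosed.splits q
  have h1 := hs.eq_prod_roots_of_monic hq
  have h2 := key q.roots fun α hα => hz α (isRoot_of_mem_roots hα)
  rw [← h1, ← hs.natDegree_eq_card_roots] at h2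
  exact h2

lemma norm_eval_zero_lt_one {q : ℂ[X]} (hq : q.Monic) (hz : ZerosInDisc q)
    (hd : q.natDegree ≠ 0) : ‖q.eval 0‖ < 1 := by
  have hs := IsAlgClosed.splits q
  have key : ∀ s : Multiset ℂ, (∀ α ∈ s, ‖α‖ < 1) →
      ‖((s.map fun α => X - C α).prod).eval 0‖ ≤ 1 ∧
        (s ≠ 0 → ‖((s.map fun α => X - C α).prod).eval 0‖ < 1) := by
    intro s
    induction s using Multiset.induction with
    | empty => simp
    | cons α s ih =>
      intro hs
      have h1 := (ih fun β hβ => hs β (Multiset.mem_cons_of_mem hβ)).1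
      have hα := hs α (Multiset.mem_cons_self α s)
      have : ‖(((α ::ₘ s).map fun α => X - C α).prod).eval 0‖ < 1 := by
        rw [Multiset.map_cons, Multiset.prod_cons, eval_mul, norm_mul]
        simp only [eval_sub, eval_X, eval_C, zero_sub, norm_neg]
        exact mul_lt_one_of_nonneg_of_lt_one_left (norm_nonneg _) hα h1
      exact ⟨this.le, fun _ => this⟩
  have h2 := (key q.roots fun α hα => hz α (isRoot_of_mem_roots hα)).2 (by
    rw [hs.natDegree_eq_card_roots] at hd
    exact fun h => hd (by rw [h]; rfl))
  rwa [← hs.eq_prod_roots_of_monic hq] at h2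

/-- Inverse Szegő recursion: a monic polynomial with all zeros in the disc is generated by
recurrence coefficients in the disc. -/
lemma exists_szegoRec_eq {m : ℕ} {q : ℂ[X]} (hq : q.Monic) (hd : q.natDegree = m)
    (hz : ZerosInDisc q) : ∃ b : ℕ → ℂ, (∀ j, ‖b j‖ < 1) ∧ q = szegoRec b m := by
  induction m generalizing q with
  | zero =>
    exact ⟨0, by simp, by rw [szegoRec]; exact hq.natDegree_eq_zero.1 hd⟩
  | succ m ih =>
    obtain ⟨b, hb⟩ : ∃ b, b = -q.eval 0 := ⟨_, rfl⟩
    have hb1 : ‖b‖ < 1 := by rw [hb, norm_neg]; exact norm_eval_zero_lt_one hq hz (by omega)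
    have hb2 : (1 - b * conj b) ≠ 0 := by
      rw [Complex.mul_conj, Complex.normSq_eq_norm_sq]
      have : (1 - ‖b‖ ^ 2 : ℝ) ≠ 0 := by nlinarith [norm_nonneg b]
      exact_mod_cast this
    set c : ℂ := (1 - b * conj b)⁻¹ with hc
    -- Solving `q = zP - bP^*`, `q^* = P^* - conj b zP` for `zP` gives `(1 - |b|²) zP = q + b q^*`;
    -- so `Q` is the candidate for `zP`.
    set Q : ℂ[X] := C c * (q + C b * star (m + 1) q) with hQ
    have hQ0 : Q.coeff 0 = 0 := by
      rw [coeff_zero_eq_eval_zero, hQ, eval_mul, eval_add, eval_mul, eval_C, eval_C,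
        eval_zero_star hq hd, hb]
      ring
    have hXQ : X * Q.divX = Q := by
      have := X_mul_divX_add Q
      rwa [hQ0, C_0, add_zero] at this
    have hQd : Q.natDegree ≤ m + 1 := by
      refine (natDegree_C_mul_le _ _).trans (natDegree_add_le_of_degree_le hd.le ?_)
      exact (natDegree_C_mul_le _ _).trans (natDegree_star_le hd.le)
    have hQc : Q.coeff (m + 1) = 1 := by
      have h1 : (star (m + 1) q).coeff (m + 1) = - conj b := by
        rw [star, coeff_reflect, revAt_le le_rfl, Nat.sub_self, coeff_map, coeff_zero_eq_eval_zero,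
          hb, map_neg, neg_neg]
      have h2 : q.coeff (m + 1) = 1 := by rw [← hd]; exact hq
      rw [hQ, coeff_C_mul, coeff_add, coeff_C_mul, h1, h2, hc]
      field_simp
      ring
    have hQ'd : Q.divX.natDegree ≤ m := by rw [natDegree_divX_eq_natDegree_tsub_one]; omega
    have hQ'c : Q.divX.coeff m = 1 := by rw [coeff_divX, hQc]
    have hQ'm : Q.divX.Monic := monic_of_natDegree_le_of_coeff_eq_one m hQ'd hQ'c
    have hQ'd' : Q.divX.natDegree = m :=
      le_antisymm hQ'd (le_natDegree_of_ne_zero (by rw [hQ'c]; exact one_ne_zero))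
    have hcc : conj c = c := by rw [hc]; simp [mul_comm]
    have hstar : star m Q.divX = C c * (star (m + 1) q + C (conj b) * q) := by
      rw [← star_succ_X_mul hQ'd, hXQ, hQ, star_C_mul, star_add, star_C_mul, star_star, hcc]
    -- A zero with `|z| ≥ 1` would give `|q| = |b| |q^*| ≤ |b| |q|` with `q(z) ≠ 0`.
    have hQ'z : ZerosInDisc Q.divX := by
      intro z hzz
      by_contra hz1
      have hz1 := not_lt.1 hz1
      have h1 := norm_eval_star_le hq hz hz1
      rw [hd] at h1
      have h2 : q.eval z ≠ 0 := fun h => not_lt.2 hz1 (hz z h)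
      have h3 : Q.eval z = 0 := by rw [← hXQ, eval_mul, hzz.eq_zero, mul_zero]
      rw [hQ, eval_mul, eval_add, eval_mul, eval_C, eval_C] at h3
      have h4 := (mul_eq_zero.1 h3).resolve_left (inv_ne_zero hb2)
      have h5 : ‖q.eval z‖ = ‖b‖ * ‖(star (m + 1) q).eval z‖ := by
        rw [eq_neg_of_add_eq_zero_left h4, norm_neg, norm_mul]
      nlinarith [norm_nonneg b, norm_pos_iff.2 h2]
    obtain ⟨b', hb', hQb⟩ := ih hQ'm hQ'd' hQ'z
    refine ⟨fun j => if j = m then b else b' j, fun j => ?_, ?_⟩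
    · dsimp only
      split_ifs
      exacts [hb1, hb' j]
    · rw [szegoRec, szegoRec_congr (b := b') (fun j hj => if_neg hj.ne), ← hQb, if_pos rfl, hstar,
        hXQ, hQ]
      have : C c * (1 - C b * C (conj b)) = 1 := by
        rw [← C_mul, ← C_1, ← C_sub, ← C_mul, hc, inv_mul_cancel₀ hb2]
      linear_combination (-q) * this

end SchurCohn

/-! ### Abstract forms on the circle and their orthogonal polynomials -/

section CircleForm

lemma linearMap_eq_zero_of_degree_lt {f : ℂ[X] →ₗ[ℂ] ℂ} {N : ℕ} (h : ∀ k < N, f (X ^ k) = 0)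
    {p : ℂ[X]} (hp : p.degree < N) : f p = 0 := by
  by_cases hp0 : p = 0
  · rw [hp0, map_zero]
  rw [p.as_sum_range' N ((natDegree_lt_iff_degree_lt hp0).2 hp), map_sum]
  refine Finset.sum_eq_zero fun k hk => ?_
  rw [← C_mul_X_pow_eq_monomial, ← smul_eq_C_mul, map_smul, h k (Finset.mem_range.1 hk), smul_zero]

lemma monic_degree_sub_lt {p q : ℂ[X]} {N : ℕ} (hp : p.Monic) (hq : q.Monic)
    (hpN : p.natDegree = N) (hqN : q.natDegree = N) : (p - q).degree < N := by
  have hd : p.degree = N := by rw [degree_eq_natDegree hp.ne_zero, hpN]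
  have hd' : q.degree = N := by rw [degree_eq_natDegree hq.ne_zero, hqN]
  exact (degree_sub_lt_left (hd.trans hd'.symm) hp.ne_zero (hp.trans hq.symm)).trans_eq hd

/-- A Hermitian form on polynomials with the algebraic properties of
`(p, q) ↦ ∫ conj p · q` for a measure on the unit circle. -/
structure CircleForm where
  form : ℂ[X] → ℂ[X] →ₗ[ℂ] ℂ
  conj_form : ∀ p q, conj (form p q) = form q p
  form_X_mul : ∀ p q, form (X * p) (X * q) = form p q
  form_star : ∀ {N : ℕ} {p q : ℂ[X]}, p.natDegree ≤ N → q.natDegree ≤ N →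
    form (star N p) (star N q) = form q p

namespace CircleForm

/-- Positive definiteness on polynomials of degree at most `N`. -/
def PosDef (B : CircleForm) (N : ℕ) : Prop :=
  ∀ p : ℂ[X], p ≠ 0 → p.natDegree ≤ N → 0 < (B.form p p).re

variable (B : CircleForm) {N : ℕ}

lemma PosDef.ne_zero {B : CircleForm} (h : B.PosDef N) {p : ℂ[X]} (hp : p ≠ 0)
    (hd : p.natDegree ≤ N) : B.form p p ≠ 0 := by
  intro h0
  have := h p hp hd
  rw [h0] at this
  exact lt_irrefl _ this

lemma form_add_left (p q r : ℂ[X]) : B.form (p + q) r = B.form p r + B.form q r := by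
  rw [← B.conj_form r, map_add, map_add, B.conj_form, B.conj_form]

lemma form_C_mul_right (c : ℂ) (p q : ℂ[X]) : B.form p (C c * q) = c * B.form p q := by
  rw [← smul_eq_C_mul, map_smul, smul_eq_mul]

lemma form_C_mul_left (c : ℂ) (p q : ℂ[X]) : B.form (C c * p) q = conj c * B.form p q := by
  rw [← B.conj_form q, form_C_mul_right, map_mul, B.conj_form]

lemma form_swap_eq_zero {p q : ℂ[X]} (h : B.form p q = 0) : B.form q p = 0 := by
  rw [← B.conj_form, h, map_zero]

lemma form_eq_zero_of_degree_lt {p q : ℂ[X]} (h : ∀ k < N, B.form (X ^ k) p = 0)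
    (hq : q.degree < N) : B.form q p = 0 :=
  B.form_swap_eq_zero
    (linearMap_eq_zero_of_degree_lt (fun k hk => B.form_swap_eq_zero (h k hk)) hq)

/-- The polynomials obtained from the form by the Szegő recurrence. -/
def poly : ℕ → ℂ[X]
  | 0 => 1
  | j + 1 => X * poly j
      - C (B.form 1 (X * poly j) / B.form 1 (star j (poly j))) * star j (poly j)

/-- The recurrence coefficients of the form. -/
def verblunsky (j : ℕ) : ℂ := B.form 1 (X * B.poly j) / B.form 1 (star j (B.poly j))

lemma poly_eq_szegoRec (j : ℕ) : B.poly j = szegoRec B.verblunsky j := by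
  induction j with
  | zero => rfl
  | succ j ih => rw [szegoRec, ← ih, poly, verblunsky]

lemma poly_monic (j : ℕ) : (B.poly j).Monic := by
  rw [poly_eq_szegoRec]; exact szegoRec_monic _ _

lemma natDegree_poly (j : ℕ) : (B.poly j).natDegree = j := by
  rw [poly_eq_szegoRec, natDegree_szegoRec]

variable {B}

/-- Reversal exchanges `X ^ k` and `X ^ (j - k)`, so orthogonality to degrees `0, …, j - 1` becomes
orthogonality to degrees `1, …, j`. -/
lemma form_X_pow_star {j : ℕ} {p : ℂ[X]} (hp : p.natDegree ≤ j)
    (h : ∀ k < j, B.form (X ^ k) p = 0) {k : ℕ} (hk : 0 < k) (hkj : k ≤ j) :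
    B.form (X ^ k) (star j p) = 0 := by
  have h1 : (X ^ k : ℂ[X]) = star j (X ^ (j - k)) := by
    rw [star_X_pow (by omega), Nat.sub_sub_self hkj]
  rw [h1, B.form_star (by simp) hp]
  exact B.form_swap_eq_zero (h _ (by omega))

/-- By reversal the left side is `form p (X ^ j)`, and `X ^ j - p` has lower degree. This makes the
denominator in `verblunsky` nonzero under positivity. -/
lemma form_one_star {j : ℕ} {p : ℂ[X]} (hp : p.Monic) (hd : p.natDegree = j)
    (h : ∀ k < j, B.form (X ^ k) p = 0) : B.form 1 (star j p) = B.form p p := by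
  have h1 : (1 : ℂ[X]) = star j (X ^ j) := by rw [star_X_pow le_rfl, Nat.sub_self, pow_zero]
  rw [h1, B.form_star (by simp) hd.le]
  have h2 := form_eq_zero_of_degree_lt B h
    (monic_degree_sub_lt (monic_X_pow j) hp (natDegree_X_pow j) hd)
  have h3 := B.form_swap_eq_zero h2
  rw [map_sub, sub_eq_zero] at h3
  exact h3

lemma PosDef.form_X_pow_poly (hB : B.PosDef N) {j : ℕ} (hj : j ≤ N) :
    ∀ k < j, B.form (X ^ k) (B.poly j) = 0 := by
  induction j with
  | zero => simp
  | succ j ih =>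
    have ih := ih (by omega)
    have hm := B.poly_monic j
    have hd := B.natDegree_poly j
    intro k hk
    rcases Nat.eq_zero_or_pos k with rfl | hk0
    · have h1 : B.form 1 (star j (B.poly j)) ≠ 0 := by
        rw [form_one_star hm hd ih]
        exact hB.ne_zero hm.ne_zero (by omega)
      rw [poly, map_sub, form_C_mul_right, pow_zero, div_mul_cancel₀ _ h1, sub_self]
    · obtain ⟨k, rfl⟩ : ∃ i, k = i + 1 := ⟨k - 1, by omega⟩
      rw [poly, map_sub, form_C_mul_right, form_X_pow_star hd.le ih hk0 (by omega), pow_succ',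
        B.form_X_mul, ih k (by omega), mul_zero, sub_zero]

/-- Pythagoras for `zΦ_j = Φ_{j+1} + aΦ_j^*`: the summands are orthogonal and `Φ_j^*` has the norm
of `Φ_j`. The index is strict because `Φ_{j+1}` must have positive norm. -/
lemma PosDef.norm_verblunsky_lt_one (hB : B.PosDef N) {j : ℕ} (hj : j < N) :
    ‖B.verblunsky j‖ < 1 := by
  set a := B.verblunsky j with ha
  have hd := B.natDegree_poly j
  have hd' := B.natDegree_poly (j + 1)
  have h0 : X * B.poly j = B.poly (j + 1) + C a * star j (B.poly j) := by
    rw [poly, ha, verblunsky]; ring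
  have hs : (star j (B.poly j)).degree < ((j + 1 : ℕ) : WithBot ℕ) :=
    degree_le_natDegree.trans_lt (Nat.cast_lt.2 (Nat.lt_succ_of_le (natDegree_star_le hd.le)))
  have h1 := form_eq_zero_of_degree_lt B (hB.form_X_pow_poly (j := j + 1) (by omega)) hs
  have h2 := B.form_swap_eq_zero h1
  have h3 : B.form (B.poly j) (B.poly j) = B.form (B.poly (j + 1)) (B.poly (j + 1))
      + (‖a‖ ^ 2 : ℝ) * B.form (B.poly j) (B.poly j) := by
    conv_lhs => rw [← B.form_X_mul]
    rw [h0, form_add_left, form_C_mul_left, map_add, map_add, form_C_mul_right,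
      form_C_mul_right, h1, h2, B.form_star hd.le hd.le, ← Complex.normSq_eq_norm_sq,
      ← Complex.mul_conj]
    ring
  have h4 := congrArg Complex.re h3
  rw [Complex.add_re, Complex.re_ofReal_mul] at h4
  have h5 := hB _ (B.poly_monic j).ne_zero (by omega)
  have h6 := hB _ (B.poly_monic (j + 1)).ne_zero (by omega)
  by_contra hlt
  nlinarith [one_le_pow₀ (not_lt.1 hlt) (n := 2)]

lemma PosDef.eq_of_orthogonal (hB : B.PosDef N) {j : ℕ} (hj : j ≤ N) {p q : ℂ[X]}
    (hp : p.Monic) (hpd : p.natDegree = j) (hpo : ∀ k < j, B.form (X ^ k) p = 0)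
    (hq : q.Monic) (hqd : q.natDegree = j) (hqo : ∀ k < j, B.form (X ^ k) q = 0) : p = q := by
  by_contra hne
  have hd := monic_degree_sub_lt hp hq hpd hqd
  have h1 := form_eq_zero_of_degree_lt B hpo hd
  have h2 := form_eq_zero_of_degree_lt B hqo hd
  refine hB.ne_zero (sub_ne_zero.2 hne) ?_ (by rw [map_sub, h1, h2, sub_zero])
  exact (natDegree_le_of_degree_le hd.le).trans hj

lemma form_one_congr {B' : CircleForm} (h : ∀ k ≤ N, B.form 1 (X ^ k) = B'.form 1 (X ^ k))
    {p : ℂ[X]} (hp : p.natDegree ≤ N) : B.form 1 p = B'.form 1 p := by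
  have := linearMap_eq_zero_of_degree_lt (f := B.form 1 - B'.form 1) (N := N + 1) (p := p)
    (fun k hk => by rw [LinearMap.sub_apply, h k (by omega), sub_self])
    (degree_le_natDegree.trans_lt (Nat.cast_lt.2 (by omega)))
  rwa [LinearMap.sub_apply, sub_eq_zero] at this

/-- The recurrence consults the form only through `form 1`, on degrees at most `j + 1` at step `j`.
-/
lemma poly_congr {B' : CircleForm} (h : ∀ k ≤ N, B.form 1 (X ^ k) = B'.form 1 (X ^ k))
    {j : ℕ} (hj : j ≤ N) : B.poly j = B'.poly j := by
  induction j with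
  | zero => rfl
  | succ j ih =>
    have hd := B'.natDegree_poly j
    rw [poly, poly, ih (by omega), form_one_congr h ?_, form_one_congr h ?_]
    · exact (natDegree_star_le hd.le).trans (by omega)
    · exact natDegree_mul_le.trans (by rw [natDegree_X, hd]; omega)

lemma verblunsky_congr {B' : CircleForm} (h : ∀ k ≤ N, B.form 1 (X ^ k) = B'.form 1 (X ^ k))
    {j : ℕ} (hj : j < N) : B.verblunsky j = B'.verblunsky j := by
  have hd := B'.natDegree_poly j
  rw [verblunsky, verblunsky, poly_congr h hj.le, form_one_congr h ?_, form_one_congr h ?_]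
  · exact (natDegree_star_le hd.le).trans (by omega)
  · exact natDegree_mul_le.trans (by rw [natDegree_X, hd]; omega)

/-- Two forms whose functionals `form 1` both annihilate monic polynomials of the degrees
`1, …, N` have the same moments up to `N`. -/
lemma form_one_X_pow_eq {B' : CircleForm} {P : ℕ → ℂ[X]} (hP : ∀ j, (P j).Monic)
    (hPd : ∀ j, (P j).natDegree = j) (h1 : B.form 1 1 = B'.form 1 1)
    (h : ∀ j, 0 < j → j ≤ N → B.form 1 (P j) = 0)
    (h' : ∀ j, 0 < j → j ≤ N → B'.form 1 (P j) = 0) :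
    ∀ k ≤ N, B.form 1 (X ^ k) = B'.form 1 (X ^ k) := by
  intro k
  induction k using Nat.strong_induction_on with
  | _ k ih =>
    intro hk
    rcases Nat.eq_zero_or_pos k with rfl | hk0
    · simpa using h1
    have h2 := linearMap_eq_zero_of_degree_lt (f := B.form 1 - B'.form 1) (N := k)
      (fun i hi => by rw [LinearMap.sub_apply, ih i hi (by omega), sub_self])
      (monic_degree_sub_lt (monic_X_pow k) (hP k) (natDegree_X_pow k) (hPd k))
    rw [map_sub, LinearMap.sub_apply, LinearMap.sub_apply, h k hk0 hk, h' k hk0 hk, sub_self,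
      sub_zero, sub_eq_zero] at h2
    exact h2

end CircleForm
end CircleForm

/-! ### The forms of `σ` and of a discrete measure -/

section Forms

lemma norm_expI (x : ℝ) : ‖expI x‖ = 1 := by
  rw [expI, mul_comm, Complex.norm_exp_ofReal_mul_I]

lemma expI_ne_zero (x : ℝ) : expI x ≠ 0 := Complex.exp_ne_zero _

lemma conj_expI (x : ℝ) : conj (expI x) = (expI x)⁻¹ := by
  rw [Complex.inv_def, Complex.normSq_eq_norm_sq, norm_expI]; simp

lemma exp_neg_natCast_mul (k : ℕ) (x : ℝ) :
    Complex.exp (-(Complex.I * ((k : ℤ) : ℂ) * x)) = ((expI x)⁻¹) ^ k := by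
  rw [expI, ← Complex.exp_neg, ← Complex.exp_nat_mul]
  congr 1
  push_cast
  ring

lemma exp_neg_neg_natCast_mul (k : ℕ) (x : ℝ) :
    Complex.exp (-(Complex.I * ((-(k : ℤ) : ℤ) : ℂ) * x)) = (expI x) ^ k := by
  rw [expI, ← Complex.exp_nat_mul]
  congr 1
  push_cast
  ring

lemma expI_injOn : Set.InjOn expI (Set.Ico 0 (2 * Real.pi)) := by
  intro x hx y hy hxy
  unfold expI at hxy
  obtain ⟨k, hk⟩ := Complex.exp_eq_exp_iff_exists_int.1 hxy
  have hk' : x = y + k * (2 * Real.pi) := by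
    have : Complex.I * (x : ℂ) = Complex.I * ((y + k * (2 * Real.pi) : ℝ) : ℂ) := by
      rw [hk]; push_cast; ring
    exact_mod_cast mul_left_cancel₀ Complex.I_ne_zero this
  have hpi := Real.pi_pos
  have h3 : (k : ℝ) < 1 := by
    by_contra h; nlinarith [hx.1, hx.2, hy.1, hy.2]
  have h4 : (-1 : ℝ) < k := by
    by_contra h; nlinarith [hx.1, hx.2, hy.1, hy.2]
  have : k = 0 := by
    have a : k < 1 := by exact_mod_cast h3
    have b : -1 < k := by exact_mod_cast h4
    omega
  simpa [this] using hk'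

lemma conj_eval_star_mul_eval_star {N : ℕ} {p q : ℂ[X]} (hp : p.natDegree ≤ N)
    (hq : q.natDegree ≤ N) {z : ℂ} (hz : ‖z‖ = 1) :
    conj ((star N p).eval z) * (star N q).eval z = conj (q.eval z) * p.eval z := by
  have h : conj (z ^ N) * z ^ N = 1 := by
    rw [mul_comm, Complex.mul_conj, Complex.normSq_eq_norm_sq, norm_pow, hz]; simp
  rw [eval_star hp hz, eval_star hq hz, map_mul, Complex.conj_conj]
  linear_combination (eval z p * conj (eval z q)) * h

lemma conj_eval_X_mul_eval_X (p q : ℂ[X]) {z : ℂ} (hz : ‖z‖ = 1) :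
    conj ((X * p).eval z) * (X * q).eval z = conj (p.eval z) * q.eval z := by
  have h : conj z * z = 1 := by
    rw [mul_comm, Complex.mul_conj, Complex.normSq_eq_norm_sq, hz]; simp
  rw [eval_mul, eval_mul, eval_X, map_mul]
  linear_combination (conj (p.eval z) * q.eval z) * h

lemma conj_one_div_two_pi : conj (1 / (2 * (Real.pi : ℂ))) = 1 / (2 * (Real.pi : ℂ)) := by
  have h : 1 / (2 * (Real.pi : ℂ)) = ((1 / (2 * Real.pi) : ℝ) : ℂ) := by push_cast; rfl
  rw [h, Complex.conj_ofReal]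

/-- The form `(1/2π) ∫ conj p · q dσ`. -/
def measureForm (σ : Measure ℝ) (hfin : σ (Set.Icc (0 : ℝ) (2 * Real.pi)) ≠ ⊤) : CircleForm where
  form p :=
    { toFun q := 1 / (2 * (Real.pi : ℂ)) * pairing σ p q
      map_add' q r := by
        rw [← mul_add]
        congr 1
        unfold pairing
        rw [← integral_add (integrable_pairing hfin p q) (integrable_pairing hfin p r)]
        simp only [eval_add, mul_add]
      map_smul' c q := by
        rw [RingHom.id_apply, smul_eq_mul, mul_left_comm]
        congr 1
        unfold pairing
        rw [← integral_const_mul]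
        simp only [eval_smul, smul_eq_mul, mul_left_comm] }
  conj_form p q := by
    change conj (_ * pairing σ p q) = _ * pairing σ q p
    rw [map_mul, pairing_conj, conj_one_div_two_pi]
  form_X_mul p q := by
    change _ * pairing σ (X * p) (X * q) = _ * pairing σ p q
    simp only [pairing, conj_eval_X_mul_eval_X p q (norm_expI _)]
  form_star {N p q} hp hq := by
    change _ * pairing σ (star N p) (star N q) = _ * pairing σ q p
    simp only [pairing, conj_eval_star_mul_eval_star hp hq (norm_expI _)]

/-- The form `∑ μ_s conj p(e^{iφ_s}) q(e^{iφ_s})`. -/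
def discreteForm {n : ℕ} (φ μ : Fin n → ℝ) : CircleForm where
  form p :=
    { toFun q := ∑ s, (μ s : ℂ) * (conj (p.eval (expI (φ s))) * q.eval (expI (φ s)))
      map_add' q r := by simp only [eval_add, mul_add, Finset.sum_add_distrib]
      map_smul' c q := by
        simp only [eval_smul, smul_eq_mul, Finset.mul_sum, RingHom.id_apply, mul_left_comm] }
  conj_form p q := by
    change conj (∑ s, (μ s : ℂ) * (conj ((p).eval (expI (φ s))) * (q).eval (expI (φ s))))
      = ∑ s, (μ s : ℂ) * (conj ((q).eval (expI (φ s))) * (p).eval (expI (φ s)))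
    rw [map_sum]
    refine Finset.sum_congr rfl fun s _ => ?_
    rw [map_mul, map_mul, Complex.conj_conj, Complex.conj_ofReal]
    ring
  form_X_mul p q := by
    change ∑ s, (μ s : ℂ) * (conj ((X * p).eval (expI (φ s))) * (X * q).eval (expI (φ s)))
      = ∑ s, (μ s : ℂ) * (conj ((p).eval (expI (φ s))) * (q).eval (expI (φ s)))
    simp only [conj_eval_X_mul_eval_X p q (norm_expI _)]
  form_star {N p q} hp hq := by
    change ∑ s, (μ s : ℂ) * (conj ((star N p).eval (expI (φ s))) * (star N q).eval (expI (φ s)))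
      = ∑ s, (μ s : ℂ) * (conj ((q).eval (expI (φ s))) * (p).eval (expI (φ s)))
    simp only [conj_eval_star_mul_eval_star hp hq (norm_expI _)]

lemma discreteForm_apply {n : ℕ} (φ μ : Fin n → ℝ) (p q : ℂ[X]) : (discreteForm φ μ).form p q
    = ∑ s, (μ s : ℂ) * (conj (p.eval (expI (φ s))) * q.eval (expI (φ s))) := rfl

lemma discreteForm_one {n : ℕ} (φ μ : Fin n → ℝ) (q : ℂ[X]) : (discreteForm φ μ).form 1 q
    = ∑ s, (μ s : ℂ) * q.eval (expI (φ s)) := by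
  simp [discreteForm_apply]

/-- A nonzero polynomial of degree at most `N` cannot vanish at `N + 1` distinct nodes. -/
lemma posDef_discreteForm {N : ℕ} {φ μ : Fin (N + 1) → ℝ} (hφ : (expI ∘ φ).Injective)
    (hμ : ∀ s, 0 < μ s) : (discreteForm φ μ).PosDef N := by
  intro p hp hd
  obtain ⟨s, hs⟩ : ∃ s, p.eval (expI (φ s)) ≠ 0 := by
    by_contra! h
    exact hp (eq_zero_of_natDegree_lt_card_of_eval_eq_zero p hφ h
      (by rw [Fintype.card_fin]; omega))
  have h1 : ∀ s, ((μ s : ℂ) * (conj (p.eval (expI (φ s))) * p.eval (expI (φ s)))).re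
      = μ s * ‖p.eval (expI (φ s))‖ ^ 2 := fun s => by
    rw [mul_comm (conj _), Complex.mul_conj, Complex.normSq_eq_norm_sq, ← Complex.ofReal_mul,
      Complex.ofReal_re]
  rw [discreteForm_apply, Complex.re_sum]
  simp only [h1]
  exact Finset.sum_pos' (fun s _ => mul_nonneg (hμ s).le (by positivity))
    ⟨s, Finset.mem_univ s, mul_pos (hμ s) (pow_pos (norm_pos_iff.2 hs) 2)⟩

variable {σ : Measure ℝ}

lemma posDef_measureForm (hconc : σ (Set.Icc (0 : ℝ) (2 * Real.pi))ᶜ = 0)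
    (hfin : σ (Set.Icc (0 : ℝ) (2 * Real.pi)) ≠ ⊤) (hinf : σ.support.Infinite) (N : ℕ) :
    (measureForm σ hfin).PosDef N := by
  intro p hp _
  have h0 := pairing_self_ne_zero hconc hfin hinf hp
  have h1 : pairing σ p p = ((∫ φ in Set.Icc (0 : ℝ) (2 * Real.pi),
      ‖p.eval (expI φ)‖ ^ 2 ∂σ : ℝ) : ℂ) := by
    rw [← integral_complex_ofReal]
    unfold pairing
    congr 1
    ext φ
    rw [mul_comm, Complex.mul_conj, Complex.normSq_eq_norm_sq]
  have h2 : (measureForm σ hfin).form p p = ((1 / (2 * Real.pi) *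
      ∫ φ in Set.Icc (0 : ℝ) (2 * Real.pi), ‖p.eval (expI φ)‖ ^ 2 ∂σ : ℝ) : ℂ) := by
    change _ * pairing σ p p = _
    rw [h1]
    push_cast
    rfl
  rw [h2, Complex.ofReal_re]
  refine mul_pos (by have := Real.pi_pos; positivity) (lt_of_le_of_ne ?_ ?_)
  · exact integral_nonneg fun φ => by positivity
  · intro h
    rw [h1, ← h] at h0
    exact h0 rfl

lemma measureForm_one_X_pow (hfin : σ (Set.Icc (0 : ℝ) (2 * Real.pi)) ≠ ⊤) (k : ℕ) :
    (measureForm σ hfin).form 1 (X ^ k) = moment σ (-(k : ℤ)) := by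
  change _ * pairing σ 1 (X ^ k) = _
  unfold moment pairing
  congr 2
  ext φ
  rw [exp_neg_neg_natCast_mul]
  simp

lemma conj_moment (k : ℤ) : conj (moment σ k) = moment σ (-k) := by
  unfold moment
  rw [map_mul, ← integral_conj]
  congr 1
  · exact conj_one_div_two_pi
  · congr 1
    ext φ
    rw [← Complex.exp_conj]
    congr 1
    simp

lemma moment_zero (hσ : σ (Set.Icc (0 : ℝ) (2 * Real.pi)) = ENNReal.ofReal (2 * Real.pi)) :
    moment σ 0 = 1 := by
  have hpi := Real.pi_pos
  simp only [moment, Int.cast_zero, mul_zero, zero_mul, neg_zero, Complex.exp_zero]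
  rw [integral_const, measureReal_restrict_apply_univ, measureReal_def, hσ,
    ENNReal.toReal_ofReal (by positivity)]
  have : (Real.pi : ℂ) ≠ 0 := by exact_mod_cast hpi.ne'
  simp
  field_simp

/-- Uniqueness of monic orthogonal polynomials; this is how the Gram–Schmidt polynomials acquire the
Szegő recurrence. -/
lemma Phi_eq_poly (hconc : σ (Set.Icc (0 : ℝ) (2 * Real.pi))ᶜ = 0)
    (hfin : σ (Set.Icc (0 : ℝ) (2 * Real.pi)) ≠ ⊤) (hinf : σ.support.Infinite) (n : ℕ) :
    Phi σ n = (measureForm σ hfin).poly n := by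
  have hB := posDef_measureForm hconc hfin hinf n
  obtain ⟨h1, h2, h3⟩ := Phi_spec hconc hfin hinf n
  refine hB.eq_of_orthogonal le_rfl h1 h2 (fun k hk => ?_) (CircleForm.poly_monic _ n)
    (CircleForm.natDegree_poly _ n) (hB.form_X_pow_poly le_rfl)
  change _ * pairing σ (X ^ k) _ = 0
  have h4 := h3 k hk
  rw [mul_eq_zero]
  right
  rw [← h4]
  unfold pairing
  congr 1
  ext φ
  have := exp_neg_natCast_mul k φ
  rw [Int.cast_natCast] at this
  rw [this, eval_pow, eval_X, map_pow, conj_expI]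

lemma recCoeff_eq_verblunsky (hconc : σ (Set.Icc (0 : ℝ) (2 * Real.pi))ᶜ = 0)
    (hfin : σ (Set.Icc (0 : ℝ) (2 * Real.pi)) ≠ ⊤) (hinf : σ.support.Infinite) (j : ℕ) :
    recCoeff σ j = (measureForm σ hfin).verblunsky j := by
  rw [recCoeff, Phi_eq_poly hconc hfin hinf, CircleForm.poly_eq_szegoRec, szegoRec]
  simp [eval_zero_star (szegoRec_monic _ j) (natDegree_szegoRec _ j)]

lemma Phi_eq_szegoRec (hconc : σ (Set.Icc (0 : ℝ) (2 * Real.pi))ᶜ = 0)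
    (hfin : σ (Set.Icc (0 : ℝ) (2 * Real.pi)) ≠ ⊤) (hinf : σ.support.Infinite) (n : ℕ) :
    Phi σ n = szegoRec (recCoeff σ) n := by
  rw [Phi_eq_poly hconc hfin hinf, CircleForm.poly_eq_szegoRec]
  exact szegoRec_congr fun j _ => (recCoeff_eq_verblunsky hconc hfin hinf j).symm

lemma norm_recCoeff_lt_one (hconc : σ (Set.Icc (0 : ℝ) (2 * Real.pi))ᶜ = 0)
    (hfin : σ (Set.Icc (0 : ℝ) (2 * Real.pi)) ≠ ⊤) (hinf : σ.support.Infinite) (j : ℕ) :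
    ‖recCoeff σ j‖ < 1 := by
  rw [recCoeff_eq_verblunsky hconc hfin hinf]
  exact (posDef_measureForm hconc hfin hinf (j + 1)).norm_verblunsky_lt_one (Nat.lt_succ_self j)

/-- The moments of `σ` of order at most `l` in absolute value agree with those of a discrete
measure as soon as the moments of nonpositive order do. -/
lemma moments_eq_iff (hfin : σ (Set.Icc (0 : ℝ) (2 * Real.pi)) ≠ ⊤) {n : ℕ} (φ μ : Fin n → ℝ)
    (l : ℕ) :
    (∀ k : ℤ, |k| ≤ l →
      moment σ k = ∑ s, (μ s : ℂ) * Complex.exp (-(Complex.I * k * φ s))) ↔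
    ∀ k ≤ l, (measureForm σ hfin).form 1 (X ^ k) = (discreteForm φ μ).form 1 (X ^ k) := by
  have h1 : ∀ k : ℕ, (discreteForm φ μ).form 1 (X ^ k)
      = ∑ s, (μ s : ℂ) * Complex.exp (-(Complex.I * ((-(k : ℤ) : ℤ) : ℂ) * φ s)) := fun k => by
    simp only [discreteForm_one, eval_pow, eval_X, exp_neg_neg_natCast_mul]
  simp only [h1, measureForm_one_X_pow]
  refine ⟨fun h k hk => h _ (by simpa using hk), fun h k hk => ?_⟩
  obtain ⟨j, rfl | rfl⟩ := k.eq_nat_or_neg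
  · have h2 := congrArg conj (h j (by simpa using hk))
    rw [conj_moment, neg_neg, map_sum] at h2
    rw [h2]
    refine Finset.sum_congr rfl fun s _ => ?_
    rw [map_mul, Complex.conj_ofReal, exp_neg_neg_natCast_mul, exp_neg_natCast_mul, map_pow,
      conj_expI]
  · exact h j (by simpa using hk)

end Forms

/-! ### The node polynomial and its cofactors -/

section Nodes

/-- The nodes polynomial with the factor of the node `s` removed. -/
def nodeCofactor {n : ℕ} (φ : Fin n → ℝ) (s : Fin n) : ℂ[X] :=
  ∏ t ∈ Finset.univ.erase s, (X - C (expI (φ t)))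

lemma X_sub_C_mul_nodeCofactor {n : ℕ} (φ : Fin n → ℝ) (s : Fin n) :
    (X - C (expI (φ s))) * nodeCofactor φ s = nodePoly φ :=
  Finset.mul_prod_erase _ (fun s => X - C (expI (φ s))) (Finset.mem_univ s)

lemma eval_nodePoly_node {n : ℕ} (φ : Fin n → ℝ) (s : Fin n) :
    (nodePoly φ).eval (expI (φ s)) = 0 := by
  rw [← X_sub_C_mul_nodeCofactor φ s]; simp

lemma eval_nodeCofactor_of_ne {n : ℕ} (φ : Fin n → ℝ) {s t : Fin n} (h : t ≠ s) :
    (nodeCofactor φ s).eval (expI (φ t)) = 0 := by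
  rw [nodeCofactor, eval_prod]
  exact Finset.prod_eq_zero (Finset.mem_erase.2 ⟨h, Finset.mem_univ t⟩) (by simp)

lemma eval_nodeCofactor_self {n : ℕ} {φ : Fin n → ℝ} (hφ : (expI ∘ φ).Injective) (s : Fin n) :
    (nodeCofactor φ s).eval (expI (φ s)) ≠ 0 := by
  rw [nodeCofactor, eval_prod, Finset.prod_ne_zero_iff]
  intro t ht
  rw [eval_sub, eval_X, eval_C, sub_ne_zero]
  exact fun h => Finset.ne_of_mem_erase ht (hφ h.symm)

lemma monic_nodePoly {n : ℕ} (φ : Fin n → ℝ) : (nodePoly φ).Monic :=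
  monic_prod_of_monic _ _ fun _ _ => monic_X_sub_C _

lemma natDegree_nodePoly {n : ℕ} (φ : Fin n → ℝ) : (nodePoly φ).natDegree = n := by
  rw [nodePoly, natDegree_prod_of_monic _ _ fun _ _ => monic_X_sub_C _]
  simp

lemma monic_nodeCofactor {n : ℕ} (φ : Fin n → ℝ) (s : Fin n) : (nodeCofactor φ s).Monic :=
  monic_prod_of_monic _ _ fun _ _ => monic_X_sub_C _

lemma natDegree_nodeCofactor {N : ℕ} (φ : Fin (N + 1) → ℝ) (s : Fin (N + 1)) :
    (nodeCofactor φ s).natDegree = N := by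
  rw [nodeCofactor, natDegree_prod_of_monic _ _ fun _ _ => monic_X_sub_C _]
  simp

lemma eval_zero_nodePoly {n : ℕ} (φ : Fin n → ℝ) :
    (nodePoly φ).eval 0 = ∏ s, -expI (φ s) := by
  simp [nodePoly, eval_prod]

lemma norm_prod_neg_expI {n : ℕ} (φ : Fin n → ℝ) : ‖∏ s, -expI (φ s)‖ = 1 := by
  rw [norm_prod]
  simp [norm_expI]

/-- A linear factor with its root `w` on the circle is its own reversal up to the factor `-conj w`.
-/
lemma star_prod_X_sub_C {ι : Type*} (t : Finset ι) (φ : ι → ℝ) :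
    star t.card (∏ s ∈ t, (X - C (expI (φ s))))
      = C (∏ s ∈ t, -conj (expI (φ s))) * ∏ s ∈ t, (X - C (expI (φ s))) := by
  classical
  induction t using Finset.induction_on with
  | empty => simp [star]
  | insert s t hs ih =>
    have hd : (∏ s ∈ t, (X - C (expI (φ s)))).natDegree ≤ t.card := by
      rw [natDegree_prod_of_monic _ _ fun _ _ => monic_X_sub_C _]
      simp
    have h1 : star 1 (X - C (expI (φ s)))
        = C (-conj (expI (φ s))) * (X - C (expI (φ s))) := by
      have h2 : C (conj (expI (φ s))) * C (expI (φ s)) = 1 := by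
        rw [← C_mul, conj_expI, inv_mul_cancel₀ (expI_ne_zero _), C_1]
      have h3 : star 1 (X - C (expI (φ s))) = 1 - C (conj (expI (φ s))) * X := by
        rw [star_sub]; simp [star, reflect_C]
      rw [h3, C_neg]
      linear_combination -h2
    rw [Finset.prod_insert hs, Finset.prod_insert hs, Finset.card_insert_of_notMem hs, add_comm,
      star_mul (natDegree_X_sub_C_le _) hd, ih, h1, C_mul]
    ring

end Nodes

/-! ### Christoffel–Darboux kernel and positive weights -/

section ChristoffelDarboux

/-- The norms `∏_{j<k} (1 - |a_j|²)` of the polynomials of the Szegő recurrence. -/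
def szegoNorm (a : ℕ → ℂ) (k : ℕ) : ℝ := ∏ j ∈ Finset.range k, (1 - ‖a j‖ ^ 2)

lemma szegoNorm_pos {a : ℕ → ℂ} {k : ℕ} (ha : ∀ j < k, ‖a j‖ < 1) : 0 < szegoNorm a k :=
  Finset.prod_pos fun j hj => by
    have := ha j (Finset.mem_range.1 hj)
    nlinarith [norm_nonneg (a j)]

lemma szegoNorm_ne_zero {a : ℕ → ℂ} {k : ℕ} (ha : ∀ j < k, ‖a j‖ < 1) :
    (szegoNorm a k : ℂ) ≠ 0 := by
  exact_mod_cast (szegoNorm_pos ha).ne'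

/-- The Christoffel–Darboux kernel, as a polynomial in its first variable. -/
def cdKernel (a : ℕ → ℂ) (k : ℕ) (w : ℂ) : ℂ[X] :=
  ∑ j ∈ Finset.range (k + 1), C (conj ((szegoRec a j).eval w) / szegoNorm a j) * szegoRec a j

/-- Induction: a recurrence step multiplies the polarized form of `|Φ^*|² - |zΦ|²` by `1 - |a_k|²`,
turning it into that of `|Φ_{k+1}^*|² - |Φ_{k+1}|²`; the new kernel term supplies the difference. -/
lemma christoffel_darboux {a : ℕ → ℂ} {k : ℕ} (ha : ∀ j < k, ‖a j‖ < 1) (w : ℂ) :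
    C (szegoNorm a k : ℂ) * (1 - C (conj w) * X) * cdKernel a k w
      = C (conj ((star k (szegoRec a k)).eval w)) * star k (szegoRec a k)
        - C (conj w * conj ((szegoRec a k).eval w)) * (X * szegoRec a k) := by
  induction k with
  | zero => simp [cdKernel, szegoNorm, szegoRec, star]
  | succ k ih =>
    have ih := ih fun j hj => ha j (by omega)
    have h0 := szegoNorm_ne_zero ha
    have h1 : (szegoNorm a (k + 1) : ℂ) = szegoNorm a k * (1 - a k * conj (a k)) := by
      rw [szegoNorm, szegoNorm, Finset.prod_range_succ, Complex.mul_conj, Complex.normSq_eq_norm_sq]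
      push_cast
      rfl
    have h2 : C (szegoNorm a (k + 1) : ℂ)
        * C (conj ((szegoRec a (k + 1)).eval w) / szegoNorm a (k + 1))
        = C (conj ((szegoRec a (k + 1)).eval w)) := by
      rw [← C_mul, mul_div_cancel₀ _ h0]
    have h3 : cdKernel a (k + 1) w = cdKernel a k w
        + C (conj ((szegoRec a (k + 1)).eval w) / szegoNorm a (k + 1)) * szegoRec a (k + 1) :=
      Finset.sum_range_succ _ _
    rw [h3, mul_add]
    have h4 : C (szegoNorm a (k + 1) : ℂ) * (1 - C (conj w) * X) * cdKernel a k w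
        = C (1 - a k * conj (a k)) *
          (C (szegoNorm a k : ℂ) * (1 - C (conj w) * X) * cdKernel a k w) := by
      rw [h1, C_mul]; ring
    have h5 : C (szegoNorm a (k + 1) : ℂ) * (1 - C (conj w) * X)
          * (C (conj ((szegoRec a (k + 1)).eval w) / szegoNorm a (k + 1)) * szegoRec a (k + 1))
        = (1 - C (conj w) * X) * (C (conj ((szegoRec a (k + 1)).eval w)) * szegoRec a (k + 1)) := by
      rw [← h2]; ring
    rw [h4, ih, h5, star_szegoRec_succ, szegoRec]
    simp only [eval_sub, eval_mul, eval_C, eval_X, map_sub, map_mul, Complex.conj_conj, map_one]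
    ring

variable {N : ℕ} {φ : Fin (N + 1) → ℝ} {a : ℕ → ℂ} {η : ℂ}

/-- At a node `w`, `W(w) = 0` expresses `Φ_N^*(w)` through `wΦ_N(w)`, so the Christoffel–Darboux
numerator becomes a multiple of `W`. Dividing by `1 - conj w z = -conj w (z - w)` leaves the
cofactor. -/
lemma C_szegoNorm_mul_cdKernel (ha : ∀ j < N, ‖a j‖ < 1) (hη : ‖η‖ = 1)
    (hW : X * szegoRec a N + C η * star N (szegoRec a N) = nodePoly φ) (s : Fin (N + 1)) :
    C (szegoNorm a N : ℂ) * cdKernel a N (expI (φ s))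
      = C (conj ((szegoRec a N).eval (expI (φ s)))) * nodeCofactor φ s := by
  set w := expI (φ s) with hw
  have hη' : (C η : ℂ[X]) * C (conj η) = 1 := by
    rw [← C_mul, Complex.mul_conj, Complex.normSq_eq_norm_sq, hη]; simp
  have hww : (C w : ℂ[X]) * C (conj w) = 1 := by
    rw [← C_mul, hw, conj_expI, mul_inv_cancel₀ (expI_ne_zero _), C_1]
  have h1 := christoffel_darboux ha w
  have h2 := congrArg (fun x => (C (conj x) : ℂ[X])) (eval_nodePoly_node φ s)
  rw [← hW, ← hw] at h2
  simp only [eval_add, eval_mul, eval_X, eval_C, map_add, map_mul, map_zero] at h2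
  have h3 := X_sub_C_mul_nodeCofactor φ s
  rw [← hW, ← hw] at h3
  have h4 : (C (conj w) : ℂ[X]) * (X - C w) ≠ 0 := by
    rw [hw, conj_expI]
    exact mul_ne_zero (C_ne_zero.2 (inv_ne_zero (expI_ne_zero _))) (X_sub_C_ne_zero _)
  refine mul_left_cancel₀ h4 ?_
  rw [C_mul] at h1
  linear_combination -h1 - C (szegoNorm a N : ℂ) * cdKernel a N w * hww
    - C (conj (eval w (szegoRec a N))) * C (conj w) * h3
    + star N (szegoRec a N) * C (conj ((star N (szegoRec a N)).eval w)) * hη'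
    - C η * star N (szegoRec a N) * h2

lemma eval_cdKernel_self (w : ℂ) : (cdKernel a N w).eval w
    = ((∑ j ∈ Finset.range (N + 1), ‖(szegoRec a j).eval w‖ ^ 2 / szegoNorm a j : ℝ) : ℂ) := by
  rw [cdKernel, eval_finsetSum]
  push_cast
  refine Finset.sum_congr rfl fun j _ => ?_
  rw [eval_mul, eval_C, div_mul_eq_mul_div, mul_comm (conj _), Complex.mul_conj,
    Complex.normSq_eq_norm_sq]
  push_cast
  rfl

lemma cdKernel_self_pos (ha : ∀ j < N, ‖a j‖ < 1) (w : ℂ) :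
    0 < ∑ j ∈ Finset.range (N + 1), ‖(szegoRec a j).eval w‖ ^ 2 / szegoNorm a j := by
  have h : ∀ j ∈ Finset.range (N + 1), 0 < szegoNorm a j := fun j hj =>
    szegoNorm_pos fun i hi => ha i (by have := Finset.mem_range.1 hj; omega)
  refine Finset.sum_pos' (fun j hj => div_nonneg (by positivity) (h j hj).le)
    ⟨0, by simp, ?_⟩
  simp [szegoRec, szegoNorm]

/-- The zeros of `z Φ_N + η Φ_N^*` are the nodes of a quadrature formula with positive weights
for which the polynomials `Φ_1, …, Φ_N` are orthogonal to `1`. -/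
lemma exists_weights (ha : ∀ j < N, ‖a j‖ < 1) (hη : ‖η‖ = 1)
    (hW : X * szegoRec a N + C η * star N (szegoRec a N) = nodePoly φ) :
    ∃ μ : Fin (N + 1) → ℝ, (∀ s, 0 < μ s) ∧
      ∀ i ≤ N, (discreteForm φ μ).form 1 (szegoRec a i) = if i = 0 then 1 else 0 := by
  have h0 := szegoNorm_ne_zero ha
  set κ : Fin (N + 1) → ℝ := fun s =>
    ∑ j ∈ Finset.range (N + 1), ‖(szegoRec a j).eval (expI (φ s))‖ ^ 2 / szegoNorm a j
  have hκ : ∀ s, 0 < κ s := fun s => cdKernel_self_pos ha _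
  let A : Matrix (Fin (N + 1)) (Fin (N + 1)) ℂ := fun t j =>
    ((κ t)⁻¹ : ℝ) * (conj ((szegoRec a j).eval (expI (φ t))) / szegoNorm a j)
  let D : Matrix (Fin (N + 1)) (Fin (N + 1)) ℂ := fun j s => (szegoRec a j).eval (expI (φ s))
  have hAD : A * D = 1 := by
    ext t s
    have h1 : (A * D) t s = ((κ t)⁻¹ : ℝ) * (cdKernel a N (expI (φ t))).eval (expI (φ s)) := by
      rw [Matrix.mul_apply, cdKernel, eval_finsetSum, Finset.mul_sum, Finset.sum_range]
      exact Finset.sum_congr rfl fun j _ => by rw [eval_mul, eval_C, mul_assoc]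
    rw [h1, Matrix.one_apply]
    split_ifs with hts
    · subst hts
      rw [eval_cdKernel_self, ← Complex.ofReal_mul]
      exact_mod_cast inv_mul_cancel₀ (hκ t).ne'
    · have h2 := congrArg (eval (expI (φ s))) (C_szegoNorm_mul_cdKernel ha hη hW t)
      rw [eval_mul, eval_mul, eval_C, eval_nodeCofactor_of_ne φ (Ne.symm hts), mul_zero] at h2
      rw [(mul_eq_zero.1 h2).resolve_left h0, mul_zero]
  -- Square matrices have two-sided inverses; column `0` of `D * A` is the claim, since `Φ_0 = 1`
  -- has norm `1`.
  have hDA : D * A = 1 := mul_eq_one_comm.1 hAD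
  refine ⟨fun s => (κ s)⁻¹, fun s => inv_pos.2 (hκ s), fun i hi => ?_⟩
  have h3 := congrFun (congrFun hDA ⟨i, by omega⟩) 0
  rw [Matrix.mul_apply, Matrix.one_apply] at h3
  simp only [Fin.ext_iff, Fin.val_zero] at h3
  rw [discreteForm_one, ← h3]
  refine Finset.sum_congr rfl fun s _ => ?_
  simp [A, D, szegoRec, szegoNorm, mul_comm]

end ChristoffelDarboux

/-! ### The node polynomial of a positive discrete measure -/

section Quadrature

variable {N : ℕ} {φ μ : Fin (N + 1) → ℝ}

/-- With `η = W(0)`, the difference `D` of the two sides has degree at most `N`, no constant term,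
and is orthogonal to `X, …, X ^ N`. Hence `D / X` is orthogonal to itself, and positivity gives `D =
0`. -/
lemma exists_X_mul_poly_add_star (hφ : (expI ∘ φ).Injective) (hμ : ∀ s, 0 < μ s) :
    ∃ η : ℂ, ‖η‖ = 1 ∧ X * (discreteForm φ μ).poly N
      + C η * star N ((discreteForm φ μ).poly N) = nodePoly φ := by
  have hB := posDef_discreteForm hφ hμ
  set B := discreteForm φ μ
  set P := B.poly N
  have hm : P.Monic := B.poly_monic N
  have hd : P.natDegree = N := B.natDegree_poly N
  have ho := hB.form_X_pow_poly le_rfl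
  refine ⟨∏ s, -expI (φ s), norm_prod_neg_expI φ, ?_⟩
  set η := ∏ s, -expI (φ s) with hη
  have hXm : (X * P).Monic := monic_X.mul hm
  have hXd : (X * P).natDegree = N + 1 := by
    rw [monic_X.natDegree_mul hm, natDegree_X, hd, add_comm]
  set D := nodePoly φ - X * P - C η * star N P with hD
  have hDd : D.natDegree ≤ N := by
    rw [← max_self N]
    refine natDegree_sub_le_of_le ?_ ((natDegree_C_mul_le _ _).trans (natDegree_star_le hd.le))
    by_cases h0 : nodePoly φ - X * P = 0
    · rw [h0]; simp
    · exact Nat.lt_succ_iff.1 ((natDegree_lt_iff_degree_lt h0).2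
        (monic_degree_sub_lt (monic_nodePoly φ) hXm (natDegree_nodePoly φ) hXd))
  have hD0 : D.coeff 0 = 0 := by
    rw [coeff_zero_eq_eval_zero, hD, eval_sub, eval_sub, eval_mul, eval_mul, eval_X, eval_C,
      eval_zero_star hm hd, eval_zero_nodePoly]
    ring
  have hDo : ∀ k < N, B.form (X ^ (k + 1)) D = 0 := fun k hk => by
    have h1 : B.form (X ^ (k + 1)) (nodePoly φ) = 0 := by
      rw [discreteForm_apply]
      simp [eval_nodePoly_node]
    have h2 : B.form (X ^ (k + 1)) (X * P) = 0 := by rw [pow_succ', B.form_X_mul, ho k hk]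
    rw [hD, map_sub, map_sub, h1, h2, B.form_C_mul_right,
      CircleForm.form_X_pow_star hd.le ho (Nat.succ_pos k) hk, mul_zero, sub_zero, sub_zero]
  have hXD : X * D.divX = D := by
    have := X_mul_divX_add D
    rwa [hD0, C_0, add_zero] at this
  have hDD : B.form D.divX D.divX = 0 := by
    by_cases hq : D.divX = 0
    · rw [hq, map_zero]
    refine B.form_eq_zero_of_degree_lt (N := N) (fun k hk => ?_) ?_
    · rw [← B.form_X_mul, hXD, ← pow_succ', hDo k hk]
    · have h1 : D.divX.natDegree + 1 ≤ N := by
        rw [← hXD, natDegree_X_mul hq] at hDd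
        exact hDd
      exact degree_le_natDegree.trans_lt (Nat.cast_lt.2 h1)
  have hD00 : D = 0 := by
    by_contra hne
    refine hB.ne_zero hne hDd ?_
    conv_lhs => rw [← hXD]
    rw [B.form_X_mul, hDD]
  rw [hD] at hD00
  linear_combination -hD00

end Quadrature

/-! ### Order of vanishing at zero as divisibility -/

section Asymptotics

/-- The neighbourhood is punctured so that the induction may divide by `z`. -/
lemma X_pow_dvd_of_isBigO {A : ℂ[X]} {k : ℕ}
    (h : (fun z => A.eval z) =O[nhdsWithin 0 {0}ᶜ] fun z : ℂ => z ^ k) : X ^ k ∣ A := by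
  induction k generalizing A with
  | zero => simp
  | succ k ih =>
    have h0 : A.eval 0 = 0 := by
      refine tendsto_nhds_unique
        ((A.continuous.tendsto 0).mono_left (nhdsWithin_le_nhds (s := {0}ᶜ))) (h.trans_tendsto ?_)
      have := (continuous_pow (M := ℂ) (k + 1)).tendsto 0
      rw [zero_pow (Nat.succ_ne_zero k)] at this
      exact this.mono_left nhdsWithin_le_nhds
    obtain ⟨Q, rfl⟩ := X_dvd_iff.2 ((coeff_zero_eq_eval_zero A).trans h0)
    rw [pow_succ']
    refine mul_dvd_mul_left X (ih ?_)
    have h1 := (Asymptotics.isBigO_refl (fun z : ℂ => z⁻¹) (nhdsWithin 0 {0}ᶜ)).mul h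
    refine h1.congr' ?_ ?_
    · filter_upwards [self_mem_nhdsWithin] with z hz
      rw [eval_mul, eval_X, inv_mul_cancel_left₀ hz]
    · filter_upwards [self_mem_nhdsWithin] with z hz
      rw [pow_succ', inv_mul_cancel_left₀ hz]

lemma isBigO_eval_div_iff {A W : ℂ[X]} (hW : W.eval 0 ≠ 0) (k : ℕ) :
    ((fun z => A.eval z / W.eval z) =O[nhds 0] fun z : ℂ => z ^ k) ↔ X ^ k ∣ A := by
  have hne : ∀ᶠ z in nhds (0 : ℂ), W.eval z ≠ 0 := (W.continuous.tendsto 0).eventually_ne hW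
  constructor
  · intro h
    have h1 : (fun z => W.eval z) =O[nhds (0 : ℂ)] fun _ => (1 : ℂ) :=
      (W.continuous.tendsto 0).isBigO_one ℂ
    refine X_pow_dvd_of_isBigO (Asymptotics.IsBigO.mono ?_ nhdsWithin_le_nhds)
    refine (h.mul h1).congr' ?_ (Filter.Eventually.of_forall fun z => mul_one _)
    filter_upwards [hne] with z hz
    exact div_mul_cancel₀ _ hz
  · rintro ⟨Q, rfl⟩
    have h1 : (fun z => Q.eval z / W.eval z) =O[nhds (0 : ℂ)] fun _ => (1 : ℂ) :=
      ((Q.continuous.tendsto 0).div (W.continuous.tendsto 0) hW).isBigO_one ℂ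
    refine ((Asymptotics.isBigO_refl (fun z : ℂ => z ^ k) _).mul h1).congr
      (fun z => ?_) fun z => mul_one _
    rw [eval_mul, eval_pow, eval_X, mul_div_assoc]

end Asymptotics

/-! ### Carathéodory functions of discrete measures -/

section Caratheodory

/-- The truncated Carathéodory series `1 + 2 ∑_{k=1}^l c_k z^k`. -/
def truncSeries (c : ℕ → ℂ) (l : ℕ) : ℂ[X] := 1 + 2 * ∑ k ∈ Finset.Icc 1 l, C (c k) * X ^ k

lemma X_pow_dvd_truncSeries_sub_iff (c d : ℕ → ℂ) (l : ℕ) :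
    X ^ (l + 1) ∣ truncSeries c l - truncSeries d l ↔ ∀ k, 1 ≤ k → k ≤ l → c k = d k := by
  have h : truncSeries c l - truncSeries d l
      = C 2 * ∑ k ∈ Finset.Icc 1 l, C (c k - d k) * X ^ k := by
    simp only [truncSeries, C_sub, sub_mul, Finset.sum_sub_distrib, C_ofNat]
    ring
  rw [h, X_pow_dvd_iff]
  simp only [coeff_C_mul, finsetSum_coeff, coeff_X_pow, mul_ite, mul_one, mul_zero,
    Finset.sum_ite_eq, Finset.mem_Icc]
  constructor
  · intro H k h1 h2
    have := H k (by omega)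
    rw [if_pos ⟨h1, h2⟩] at this
    exact sub_eq_zero.1 ((mul_eq_zero.1 this).resolve_left two_ne_zero)
  · intro H k hk
    split_ifs with h1
    · rw [H k h1.1 h1.2, sub_self, mul_zero]
    · rfl

/-- The truncation error of `(w + z)/(w - z) = 1 + 2 ∑ w⁻ᵏ zᵏ`, cleared of its denominator: the
geometric sum telescopes to one monomial. -/
lemma X_sub_C_mul_truncSeries {w : ℂ} (hw : w ≠ 0) (l : ℕ) :
    (X - C w) * (1 - truncSeries (fun k => w⁻¹ ^ k) l) - 2 * X
      = -2 * C (w⁻¹ ^ l) * X ^ (l + 1) := by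
  have h : C w * C w⁻¹ = 1 := by rw [← C_mul, mul_inv_cancel₀ hw, C_1]
  induction l with
  | zero => simp [truncSeries]
  | succ l ih =>
    have h1 : truncSeries (fun k => w⁻¹ ^ k) (l + 1)
        = truncSeries (fun k => w⁻¹ ^ k) l + 2 * (C (w⁻¹ ^ (l + 1)) * X ^ (l + 1)) := by
      rw [truncSeries, truncSeries, Finset.sum_Icc_succ_top (by omega)]
      ring
    rw [h1]
    simp only [C_pow] at ih ⊢
    linear_combination ih + 2 * (C w⁻¹) ^ l * X ^ (l + 1) * h

variable {N : ℕ} {φ μ : Fin (N + 1) → ℝ}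

/-- The polynomial `∑ μ_s ∏_{t ≠ s} (z - e^{iφ_t})`. -/
def weightedSum (φ μ : Fin (N + 1) → ℝ) : ℂ[X] := ∑ s, C (μ s : ℂ) * nodeCofactor φ s

lemma sub_sum_mul_sub_sum_mul {R ι : Type*} [CommRing R] (t : Finset ι) (a c S : ι → R) (W x : R)
    (h : ∑ s ∈ t, a s = 1) :
    W - x * ∑ s ∈ t, a s * c s - (∑ s ∈ t, a s * S s) * W
      = ∑ s ∈ t, a s * (W - x * c s - S s * W) := by
  have h1 : W = ∑ s ∈ t, a s * W := by rw [← Finset.sum_mul, h, one_mul]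
  conv_lhs => enter [1, 1]; rw [h1]
  rw [Finset.mul_sum, Finset.sum_mul, ← Finset.sum_sub_distrib, ← Finset.sum_sub_distrib]
  exact Finset.sum_congr rfl fun s _ => by ring

lemma sum_C_eq_one (hμ : ∑ s, μ s = 1) : ∑ s, C (μ s : ℂ) = 1 := by
  rw [← map_sum, ← C_1]
  exact_mod_cast congrArg (fun x : ℝ => C (x : ℂ)) hμ

lemma truncSeries_sum (hμ : ∑ s, μ s = 1) (d : Fin (N + 1) → ℕ → ℂ) (l : ℕ) :
    truncSeries (fun k => ∑ s, (μ s : ℂ) * d s k) l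
      = ∑ s, C (μ s : ℂ) * truncSeries (d s) l := by
  have h : ∑ k ∈ Finset.Icc 1 l, C (∑ s, (μ s : ℂ) * d s k) * X ^ k
      = ∑ s, C (μ s : ℂ) * ∑ k ∈ Finset.Icc 1 l, C (d s k) * X ^ k := by
    simp only [map_sum, Finset.sum_mul, Finset.mul_sum]
    rw [Finset.sum_comm]
    simp only [C_mul, mul_assoc]
  rw [truncSeries, h, ← sum_C_eq_one hμ, Finset.mul_sum, ← Finset.sum_add_distrib]
  refine Finset.sum_congr rfl fun s _ => ?_
  rw [truncSeries]
  ring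

lemma X_pow_dvd_caratheodory (hμ : ∑ s, μ s = 1) (l : ℕ) :
    X ^ (l + 1) ∣ nodePoly φ - 2 * X * weightedSum φ μ
      - truncSeries (fun k => ∑ s, (μ s : ℂ) * (expI (φ s))⁻¹ ^ k) l * nodePoly φ := by
  rw [truncSeries_sum hμ, weightedSum, sub_sum_mul_sub_sum_mul _ _ _ _ _ _ (sum_C_eq_one hμ)]
  refine Finset.dvd_sum fun s _ => Dvd.dvd.mul_left ?_ _
  have h4 := X_sub_C_mul_truncSeries (expI_ne_zero (φ s)) l
  refine ⟨nodeCofactor φ s * (-2 * C ((expI (φ s))⁻¹ ^ l)), ?_⟩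
  rw [← X_sub_C_mul_nodeCofactor φ s]
  linear_combination nodeCofactor φ s * h4

lemma caratheodory_isBigO_iff (hμ : ∑ s, μ s = 1) {p q : ℂ[X]} (hp : p = weightedSum φ μ)
    (hq : X * p + q = nodePoly φ) (c : ℕ → ℂ) (l : ℕ) :
    ((fun z : ℂ => (q.eval z - z * p.eval z) / (q.eval z + z * p.eval z)
        - (1 + 2 * ∑ k ∈ Finset.Icc 1 l, c k * z ^ k)) =O[nhds 0] fun z : ℂ => z ^ (l + 1)) ↔
      ∀ k, 1 ≤ k → k ≤ l → c k = ∑ s, (μ s : ℂ) * (expI (φ s))⁻¹ ^ k := by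
  have hW0 : (nodePoly φ).eval 0 ≠ 0 := by
    rw [eval_zero_nodePoly, ← norm_ne_zero_iff, norm_prod_neg_expI]
    exact one_ne_zero
  have hne : ∀ᶠ z in nhds (0 : ℂ), (nodePoly φ).eval z ≠ 0 :=
    ((nodePoly φ).continuous.tendsto 0).eventually_ne hW0
  set A := nodePoly φ - 2 * X * p - truncSeries c l * nodePoly φ with hA
  have h1 : (fun z : ℂ => (q.eval z - z * p.eval z) / (q.eval z + z * p.eval z)
        - (1 + 2 * ∑ k ∈ Finset.Icc 1 l, c k * z ^ k))
      =ᶠ[nhds 0] fun z => A.eval z / (nodePoly φ).eval z := by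
    filter_upwards [hne] with z hz
    have h2 : (nodePoly φ).eval z = q.eval z + z * p.eval z := by
      rw [← hq, eval_add, eval_mul, eval_X, add_comm]
    have h3 : (truncSeries c l).eval z = 1 + 2 * ∑ k ∈ Finset.Icc 1 l, c k * z ^ k := by
      simp [truncSeries, eval_finsetSum]
    rw [← h3, hA, eq_div_iff hz, sub_mul, ← h2, div_mul_cancel₀ _ hz]
    simp only [eval_sub, eval_mul, eval_X, eval_ofNat, h2]
    ring
  rw [Asymptotics.isBigO_congr h1 (Filter.EventuallyEq.refl _ _), isBigO_eval_div_iff hW0,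
    ← X_pow_dvd_truncSeries_sub_iff c (fun k => ∑ s, (μ s : ℂ) * (expI (φ s))⁻¹ ^ k)]
  set S := truncSeries (fun k => ∑ s, (μ s : ℂ) * (expI (φ s))⁻¹ ^ k) l with hS
  have h4 := X_pow_dvd_caratheodory (φ := φ) hμ l
  rw [← hp, ← hS] at h4
  -- The numerator built with `S` is already divisible by `X ^ (l + 1)`, so only `(truncSeries c l -
  -- S) * W` matters, and `W(0) ≠ 0` lets `W` be cancelled.
  have h5 : A = nodePoly φ - 2 * X * p - S * nodePoly φ
      - (truncSeries c l - S) * nodePoly φ := by rw [hA]; ring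
  rw [h5, dvd_sub_right h4]
  refine ⟨fun h => prime_X.pow_dvd_of_dvd_mul_right _ ?_ h, fun h => h.mul_right _⟩
  rwa [X_dvd_iff, coeff_zero_eq_eval_zero]

lemma coeff_weightedSum : (weightedSum φ μ).coeff N = ∑ s, (μ s : ℂ) := by
  rw [weightedSum, finsetSum_coeff]
  refine Finset.sum_congr rfl fun s _ => ?_
  have : (nodeCofactor φ s).coeff N = 1 := by
    have := monic_nodeCofactor φ s
    rwa [Monic, leadingCoeff, natDegree_nodeCofactor] at this
  rw [coeff_C_mul, this, mul_one]

lemma natDegree_weightedSum_le : (weightedSum φ μ).natDegree ≤ N :=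
  natDegree_sum_le_of_forall_le _ _ fun s _ =>
    (natDegree_C_mul_le _ _).trans (natDegree_nodeCofactor φ s).le

lemma weightedSum_monic_natDegree (hμ : ∑ s, μ s = 1) :
    (weightedSum φ μ).Monic ∧ (weightedSum φ μ).natDegree = N := by
  have h1 := natDegree_weightedSum_le (φ := φ) (μ := μ)
  have h3 : (weightedSum φ μ).coeff N = 1 := by rw [coeff_weightedSum]; exact_mod_cast hμ
  exact ⟨monic_of_natDegree_le_of_coeff_eq_one N h1 h3,
    le_antisymm h1 (le_natDegree_of_ne_zero (by rw [h3]; exact one_ne_zero))⟩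

lemma eval_weightedSum_node (s : Fin (N + 1)) : (weightedSum φ μ).eval (expI (φ s))
    = μ s * (nodeCofactor φ s).eval (expI (φ s)) := by
  rw [weightedSum, eval_finsetSum, Finset.sum_eq_single s]
  · rw [eval_mul, eval_C]
  · intro t _ hts
    rw [eval_mul, eval_nodeCofactor_of_ne φ hts.symm, mul_zero]
  · simp

/-- The excess over `1` is the real part of `(z + w)/(z - w)`, that is `(|z|² - |w|²)/|z - w|²`. -/
lemma re_two_mul_div_sub {z w : ℂ} (hw : ‖w‖ = 1) (hz : 1 ≤ ‖z‖) (hne : z ≠ w) :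
    1 ≤ (2 * z / (z - w)).re := by
  have h0 : z - w ≠ 0 := sub_ne_zero.2 hne
  have h1 : 2 * z / (z - w) = 1 + (z + w) / (z - w) := by field_simp; ring
  have h2 : ((z + w) / (z - w)).re = (‖z‖ ^ 2 - ‖w‖ ^ 2) / ‖z - w‖ ^ 2 := by
    rw [Complex.div_re, ← add_div]
    simp only [← Complex.normSq_eq_norm_sq]
    congr 1
    simp only [Complex.normSq_apply, Complex.add_re, Complex.add_im, Complex.sub_re, Complex.sub_im]
    ring
  rw [h1, Complex.add_re, Complex.one_re, h2, le_add_iff_nonneg_right, hw]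
  exact div_nonneg (by nlinarith) (by positivity)

/-- Off the nodes, `2zp/W` is a convex combination of terms with real part at least `1`. At a node
only its own cofactor survives, and it is nonzero there. -/
lemma zerosInDisc_weightedSum (hφ : (expI ∘ φ).Injective) (hμ : ∀ s, 0 < μ s)
    (hμ1 : ∑ s, μ s = 1) : ZerosInDisc (weightedSum φ μ) := by
  intro z hz
  by_contra hz1
  have hz1 := not_lt.1 hz1
  have hne : ∀ s, z ≠ expI (φ s) := by
    rintro s rfl
    rw [IsRoot, eval_weightedSum_node] at hz
    exact mul_ne_zero (by exact_mod_cast (hμ s).ne') (eval_nodeCofactor_self hφ s) hz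
  have h1 : (nodePoly φ).eval z * ∑ s, (μ s : ℂ) * (2 * z / (z - expI (φ s)))
      = 2 * z * (weightedSum φ μ).eval z := by
    rw [weightedSum, eval_finsetSum, Finset.mul_sum, Finset.mul_sum]
    refine Finset.sum_congr rfl fun s _ => ?_
    have := sub_ne_zero.2 (hne s)
    rw [← X_sub_C_mul_nodeCofactor φ s, eval_mul, eval_mul, eval_sub, eval_X, eval_C, eval_C]
    field_simp
  rw [hz.eq_zero, mul_zero] at h1
  have h2 : (nodePoly φ).eval z ≠ 0 := by
    rw [nodePoly, eval_prod, Finset.prod_ne_zero_iff]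
    intro s _
    rw [eval_sub, eval_X, eval_C]
    exact sub_ne_zero.2 (hne s)
  have h3 := congrArg Complex.re ((mul_eq_zero.1 h1).resolve_left h2)
  rw [Complex.re_sum] at h3
  have h4 : ∑ s, μ s ≤ ∑ s, ((μ s : ℂ) * (2 * z / (z - expI (φ s)))).re :=
    Finset.sum_le_sum fun s _ => by
      rw [Complex.re_ofReal_mul]
      exact le_mul_of_one_le_right (hμ s).le (re_two_mul_div_sub (norm_expI _) hz1 (hne s))
  rw [h3, hμ1, Complex.zero_re] at h4
  exact absurd h4 (by norm_num)

/-- For a single cofactor `g` at `w`, `ηg^* = -wg`, so `zg + ηg^* = W`; then average over the nodes.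
-/
lemma X_mul_weightedSum_add_star (hμ : ∑ s, μ s = 1) :
    X * weightedSum φ μ + C (∏ s, -expI (φ s)) * star N (weightedSum φ μ) = nodePoly φ := by
  have h1 := sum_C_eq_one hμ
  have h2 : star N (weightedSum φ μ) = ∑ s, C (μ s : ℂ) * star N (nodeCofactor φ s) := by
    ext i
    simp [weightedSum, star, coeff_reflect, finsetSum_coeff]
  have h3 : ∀ s, C (∏ s, -expI (φ s)) * star N (nodeCofactor φ s)
      = -C (expI (φ s)) * nodeCofactor φ s := fun s => by
    have h4 := star_prod_X_sub_C (Finset.univ.erase s) φ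
    rw [Finset.card_erase_of_mem (Finset.mem_univ s), Finset.card_univ, Fintype.card_fin,
      Nat.add_sub_cancel] at h4
    rw [nodeCofactor, h4, ← mul_assoc, ← C_mul, ← Finset.mul_prod_erase _ _ (Finset.mem_univ s),
      mul_assoc, ← Finset.prod_mul_distrib, Finset.prod_eq_one, mul_one, C_neg]
    intro t _
    rw [neg_mul_neg, conj_expI, mul_inv_cancel₀ (expI_ne_zero _)]
  rw [h2, weightedSum, Finset.mul_sum, Finset.mul_sum, ← Finset.sum_add_distrib]
  calc _ = ∑ s, C (μ s : ℂ) * nodePoly φ := by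
        refine Finset.sum_congr rfl fun s _ => ?_
        rw [← X_sub_C_mul_nodeCofactor φ s]
        linear_combination C (μ s : ℂ) * h3 s
    _ = nodePoly φ := by rw [← Finset.sum_mul, h1, one_mul]

/-- A monic polynomial `p` with zeros in the disc and `z p + η p^* = ∏ (z - e^{iφ_s})` is a
combination of the cofactors with positive weights of sum one. -/
lemma exists_eq_weightedSum (hφ : (expI ∘ φ).Injective) {p : ℂ[X]} (hp : p.Monic)
    (hd : p.natDegree = N) (hz : ZerosInDisc p) {η : ℂ} (hη : ‖η‖ = 1)
    (hW : X * p + C η * star N p = nodePoly φ) :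
    ∃ μ : Fin (N + 1) → ℝ, (∀ s, 0 < μ s) ∧ ∑ s, μ s = 1 ∧ p = weightedSum φ μ := by
  obtain ⟨b, hb, hpb⟩ := exists_szegoRec_eq hp hd hz
  have hb' : ∀ j < N, ‖b j‖ < 1 := fun j _ => hb j
  set κ : Fin (N + 1) → ℝ := fun s =>
    ∑ j ∈ Finset.range (N + 1), ‖(szegoRec b j).eval (expI (φ s))‖ ^ 2 / szegoNorm b j
  have hκ : ∀ s, 0 < κ s := fun s => cdKernel_self_pos hb' _
  have hh := szegoNorm_pos hb'
  have hp0 : ∀ s, p.eval (expI (φ s)) ≠ 0 := fun s h => by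
    have := hz _ h
    rw [norm_expI] at this
    exact lt_irrefl _ this
  -- Multiplying the kernel identity at `w_s` by `p(w_s)` shows that this is the ratio of `p` to the
  -- cofactor there.
  set μ : Fin (N + 1) → ℝ := fun s => ‖p.eval (expI (φ s))‖ ^ 2 / (szegoNorm b N * κ s) with hμ
  have hμ0 : ∀ s, 0 < μ s := fun s =>
    div_pos (pow_pos (norm_pos_iff.2 (hp0 s)) 2) (mul_pos hh (hκ s))
  have hev : ∀ s, p.eval (expI (φ s)) = μ s * (nodeCofactor φ s).eval (expI (φ s)) := fun s => by
    have h1 := congrArg (eval (expI (φ s)))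
      (C_szegoNorm_mul_cdKernel hb' hη (by rw [← hpb]; exact hW) s)
    rw [eval_mul, eval_mul, eval_C, eval_C, eval_cdKernel_self, ← hpb, ← Complex.ofReal_mul] at h1
    have h2 : ((szegoNorm b N * κ s : ℝ) : ℂ) ≠ 0 := by
      exact_mod_cast (mul_pos hh (hκ s)).ne'
    have h3 : (μ s : ℂ) = p.eval (expI (φ s)) * conj (p.eval (expI (φ s)))
        / ((szegoNorm b N * κ s : ℝ) : ℂ) := by
      rw [Complex.mul_conj, Complex.normSq_eq_norm_sq, ← Complex.ofReal_div]
    rw [h3, div_mul_eq_mul_div, eq_div_iff h2, mul_assoc, ← h1]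
  have hpμ : p = weightedSum φ μ := by
    have hdeg : ∀ r : ℂ[X], r.natDegree ≤ N →
        r.degree < ((Finset.univ : Finset (Fin (N + 1))).card : WithBot ℕ) := fun r hr => by
      rw [Finset.card_univ, Fintype.card_fin]
      exact degree_le_natDegree.trans_lt (Nat.cast_lt.2 (by omega))
    refine eq_of_degrees_lt_of_eval_index_eq (v := expI ∘ φ) Finset.univ hφ.injOn (hdeg _ hd.le)
      (hdeg _ natDegree_weightedSum_le) fun s _ => ?_
    rw [Function.comp_apply, eval_weightedSum_node, hev s]
  refine ⟨μ, hμ0, ?_, hpμ⟩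
  have h3 : p.coeff N = 1 := by rw [← hd]; exact hp
  rw [hpμ, coeff_weightedSum] at h3
  exact_mod_cast h3

end Caratheodory

/-! ### The individual implications -/

section Equivalences

variable {σ : Measure ℝ} {l m : ℕ} {φ : Fin (l + m + 1) → ℝ}

lemma exists_szegoRec_of_quadrature (hconc : σ (Set.Icc (0 : ℝ) (2 * Real.pi))ᶜ = 0)
    (hfin : σ (Set.Icc (0 : ℝ) (2 * Real.pi)) ≠ ⊤) (hinf : σ.support.Infinite)
    (hφ : (expI ∘ φ).Injective) {μ : Fin (l + m + 1) → ℝ} (hμ : ∀ s, 0 < μ s)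
    (h : ∀ k : ℤ, |k| ≤ l → moment σ k = ∑ s, (μ s : ℂ) * Complex.exp (-(Complex.I * k * φ s))) :
    ∃ (a : ℕ → ℂ) (η : ℂ), (∀ j, j < l + m → ‖a j‖ < 1) ∧ (∀ j, j < l → a j = recCoeff σ j) ∧
      ‖η‖ = 1 ∧
      X * szegoRec a (l + m) + C η * star (l + m) (szegoRec a (l + m)) = nodePoly φ := by
  obtain ⟨η, hη, hW⟩ := exists_X_mul_poly_add_star hφ hμ
  rw [CircleForm.poly_eq_szegoRec] at hW
  refine ⟨_, η, fun j hj => (posDef_discreteForm hφ hμ).norm_verblunsky_lt_one hj,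
    fun j hj => ?_, hη, hW⟩
  rw [recCoeff_eq_verblunsky hconc hfin hinf]
  exact (CircleForm.verblunsky_congr ((moments_eq_iff hfin φ μ l).1 h) hj).symm

lemma exists_quadrature_of_szegoRec (hconc : σ (Set.Icc (0 : ℝ) (2 * Real.pi))ᶜ = 0)
    (hmass : σ (Set.Icc (0 : ℝ) (2 * Real.pi)) = ENNReal.ofReal (2 * Real.pi))
    (hinf : σ.support.Infinite) {a : ℕ → ℂ} {η : ℂ} (ha : ∀ j, j < l + m → ‖a j‖ < 1)
    (har : ∀ j, j < l → a j = recCoeff σ j) (hη : ‖η‖ = 1)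
    (hW : X * szegoRec a (l + m) + C η * star (l + m) (szegoRec a (l + m)) = nodePoly φ) :
    ∃ μ : Fin (l + m + 1) → ℝ, (∀ s, 0 < μ s) ∧ ∀ k : ℤ, |k| ≤ l →
      moment σ k = ∑ s, (μ s : ℂ) * Complex.exp (-(Complex.I * k * φ s)) := by
  have hfin : σ (Set.Icc (0 : ℝ) (2 * Real.pi)) ≠ ⊤ := by rw [hmass]; exact ENNReal.ofReal_ne_top
  obtain ⟨μ, hμ, h⟩ := exists_weights ha hη hW
  refine ⟨μ, hμ, (moments_eq_iff hfin φ μ l).2 (CircleForm.form_one_X_pow_eq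
    (szegoRec_monic a) (natDegree_szegoRec a) ?_ (fun j hj hjl => ?_) fun j hj hjl => ?_)⟩
  · have h1 := h 0 (Nat.zero_le _)
    have h2 := measureForm_one_X_pow hfin 0
    rw [pow_zero, Nat.cast_zero, neg_zero, moment_zero hmass] at h2
    rw [h2]
    exact h1.symm
  -- For `j ≤ l` only the coefficients shared with `σ` enter, so the polynomial is `Phi σ j`,
  -- orthogonal to `1` for `σ` too.
  · rw [szegoRec_congr (b := recCoeff σ) fun i hi => har i (by omega),
      ← Phi_eq_szegoRec hconc hfin hinf, Phi_eq_poly hconc hfin hinf]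
    simpa using (posDef_measureForm hconc hfin hinf j).form_X_pow_poly le_rfl 0 hj
  · rw [h j (by omega), if_neg hj.ne']

lemma exists_factor_of_szegoRec (hconc : σ (Set.Icc (0 : ℝ) (2 * Real.pi))ᶜ = 0)
    (hfin : σ (Set.Icc (0 : ℝ) (2 * Real.pi)) ≠ ⊤) (hinf : σ.support.Infinite)
    {a : ℕ → ℂ} {η : ℂ} (ha : ∀ j, j < l + m → ‖a j‖ < 1)
    (har : ∀ j, j < l → a j = recCoeff σ j) (hη : ‖η‖ = 1)
    (hW : X * szegoRec a (l + m) + C η * star (l + m) (szegoRec a (l + m)) = nodePoly φ) :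
    ∃ (q : ℂ[X]) (η : ℂ), q.Monic ∧ q.natDegree = m ∧ ZerosInDisc q ∧ ‖η‖ = 1 ∧
      X * q * Phi σ l + C η * star m q * star l (Phi σ l) = nodePoly φ := by
  set b : ℕ → ℂ := fun i => η * conj (a (l + m - 1 - i)) with hb
  refine ⟨szegoRec b m, η, szegoRec_monic b m, natDegree_szegoRec b m,
    zerosInDisc_szegoRec fun j hj => ?_, hη, ?_⟩
  · rw [hb]
    dsimp only
    rw [norm_mul, hη, one_mul, RCLike.norm_conj]
    exact ha _ (by omega)
  · rw [Phi_eq_szegoRec hconc hfin hinf, ← szegoRec_congr har, ← hW,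
      X_mul_szegoRec_add_star a b hη l m fun _ _ => rfl]

lemma exists_szegoRec_of_factor (hconc : σ (Set.Icc (0 : ℝ) (2 * Real.pi))ᶜ = 0)
    (hfin : σ (Set.Icc (0 : ℝ) (2 * Real.pi)) ≠ ⊤) (hinf : σ.support.Infinite)
    {q : ℂ[X]} {η : ℂ} (hq : q.Monic) (hd : q.natDegree = m) (hz : ZerosInDisc q) (hη : ‖η‖ = 1)
    (hW : X * q * Phi σ l + C η * star m q * star l (Phi σ l) = nodePoly φ) :
    ∃ (a : ℕ → ℂ) (η : ℂ), (∀ j, j < l + m → ‖a j‖ < 1) ∧ (∀ j, j < l → a j = recCoeff σ j) ∧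
      ‖η‖ = 1 ∧
      X * szegoRec a (l + m) + C η * star (l + m) (szegoRec a (l + m)) = nodePoly φ := by
  obtain ⟨b, hb, rfl⟩ := exists_szegoRec_eq hq hd hz
  -- The coefficients of `σ`, followed by those of `q` reversed, conjugated and rotated; since `|η|
  -- = 1`, this inverts the passage from tail to `q`.
  set a : ℕ → ℂ := fun j => if j < l then recCoeff σ j else η * conj (b (l + m - 1 - j)) with ha
  have har : ∀ j, j < l → a j = recCoeff σ j := fun j hj => if_pos hj
  have hη' : η * conj η = 1 := by
    rw [Complex.mul_conj, Complex.normSq_eq_norm_sq, hη]; simp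
  have hba : ∀ i < m, b i = η * conj (a (l + m - 1 - i)) := fun i hi => by
    have h1 : a (l + m - 1 - i) = η * conj (b (l + m - 1 - (l + m - 1 - i))) :=
      if_neg (by omega)
    rw [h1, Nat.sub_sub_self (by omega), map_mul, Complex.conj_conj, ← mul_assoc, hη', one_mul]
  refine ⟨a, η, fun j _ => ?_, har, hη, ?_⟩
  · by_cases hj : j < l
    · rw [har j hj]
      exact norm_recCoeff_lt_one hconc hfin hinf j
    · rw [ha]
      dsimp only
      rw [if_neg hj, norm_mul, hη, one_mul, RCLike.norm_conj]
      exact hb _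
  · rw [X_mul_szegoRec_add_star a b hη l m hba, szegoRec_congr har,
      ← Phi_eq_szegoRec hconc hfin hinf, hW]

lemma moments_eq_iff_pos (hmass : σ (Set.Icc (0 : ℝ) (2 * Real.pi)) = ENNReal.ofReal (2 * Real.pi))
    {n : ℕ} (φ μ : Fin n → ℝ) (l : ℕ) :
    (∀ k : ℤ, |k| ≤ l →
      moment σ k = ∑ s, (μ s : ℂ) * Complex.exp (-(Complex.I * k * φ s))) ↔
    ∑ s, μ s = 1 ∧ ∀ k : ℕ, 1 ≤ k → k ≤ l →
      moment σ (k : ℤ) = ∑ s, (μ s : ℂ) * (expI (φ s))⁻¹ ^ k := by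
  constructor
  · intro h
    refine ⟨?_, fun k _ hk => ?_⟩
    · have h0 := h 0 (by simp)
      rw [moment_zero hmass] at h0
      simp only [Int.cast_zero, mul_zero, zero_mul, neg_zero, Complex.exp_zero, mul_one] at h0
      exact_mod_cast h0.symm
    · have h1 := h k (by simpa using hk)
      simpa only [exp_neg_natCast_mul] using h1
  · rintro ⟨h0, h1⟩
    have h2 : ∀ k : ℕ, k ≤ l → moment σ (k : ℤ) = ∑ s, (μ s : ℂ) * (expI (φ s))⁻¹ ^ k := by
      intro k hk
      rcases Nat.eq_zero_or_pos k with rfl | hk0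
      · simp only [pow_zero, mul_one, Nat.cast_zero, moment_zero hmass]
        exact_mod_cast h0.symm
      · exact h1 k hk0 hk
    intro k hk
    obtain ⟨j, rfl | rfl⟩ := k.eq_nat_or_neg
    · simpa only [exp_neg_natCast_mul] using h2 j (by simpa using hk)
    · rw [← conj_moment, h2 j (by simpa using hk), map_sum]
      refine Finset.sum_congr rfl fun s _ => ?_
      rw [exp_neg_neg_natCast_mul, map_mul, map_pow, map_inv₀, conj_expI, inv_inv,
        Complex.conj_ofReal]

end Equivalences

end PositiveQF

end

/-- `σ` is a positive measure on `[0, 2π]` with total mass `2π` and infinite support;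
`φ` is the list of nodes `0 ≤ φ_1 < … < φ_n < 2π`, and `0 ≤ m ≤ n - 1`. -/
theorem mainTheorem1 (σ : MeasureTheory.Measure ℝ)
    (hσ_conc : σ (Set.Icc (0 : ℝ) (2 * Real.pi))ᶜ = 0)
    (hσ_mass : σ (Set.Icc (0 : ℝ) (2 * Real.pi)) = ENNReal.ofReal (2 * Real.pi))
    (hσ_supp : σ.support.Infinite)
    (n m : ℕ) (hmn : m < n)
    (φ : Fin n → ℝ) (hφ_mono : StrictMono φ) (hφ_mem : ∀ s, φ s ∈ Set.Ico (0 : ℝ) (2 * Real.pi)) :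
    List.TFAE [
      -- (a) positive quadrature formula
      ∃ μ : Fin n → ℝ, (∀ s, 0 < μ s) ∧
        ∀ k : ℤ, |k| ≤ (n : ℤ) - m - 1 →
          PositiveQF.moment σ k
            = ∑ s, (μ s : ℂ) * Complex.exp (-(Complex.I * k * φ s)),
      -- (b) recurrence relation
      ∃ (a : ℕ → ℂ) (η : ℂ),
        (∀ j, j < n - 1 → ‖a j‖ < 1) ∧
        (∀ j, j < n - m - 1 → a j = PositiveQF.recCoeff σ j) ∧
        ‖η‖ = 1 ∧
        X * PositiveQF.szegoRec a (n - 1)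
            + C η * PositiveQF.star (n - 1) (PositiveQF.szegoRec a (n - 1))
          = PositiveQF.nodePoly φ,
      -- (c) representation by a polynomial of degree `m`
      ∃ (q : ℂ[X]) (η : ℂ),
        q.Monic ∧ q.natDegree = m ∧ PositiveQF.ZerosInDisc q ∧ ‖η‖ = 1 ∧
        X * q * PositiveQF.Phi σ (n - m - 1)
            + C η * PositiveQF.star m q
              * PositiveQF.star (n - m - 1) (PositiveQF.Phi σ (n - m - 1))
          = PositiveQF.nodePoly φ,
      -- (d) representation by a polynomial of degree `n - 1`
      ∃ (p : ℂ[X]) (η : ℂ),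
        p.Monic ∧ p.natDegree = n - 1 ∧ PositiveQF.ZerosInDisc p ∧ ‖η‖ = 1 ∧
        X * p + C η * PositiveQF.star (n - 1) p = PositiveQF.nodePoly φ ∧
        (fun z : ℂ =>
          (η * (PositiveQF.star (n - 1) p).eval z - z * p.eval z)
              / (η * (PositiveQF.star (n - 1) p).eval z + z * p.eval z)
            - (1 + 2 * ∑ k ∈ Finset.Icc 1 (n - m - 1), PositiveQF.moment σ (k : ℤ) * z ^ k))
          =O[nhds 0] (fun z : ℂ => z ^ (n - m))] := by
  have hfin : σ (Set.Icc (0 : ℝ) (2 * Real.pi)) ≠ ⊤ := by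
    rw [hσ_mass]; exact ENNReal.ofReal_ne_top
  have hφ : (PositiveQF.expI ∘ φ).Injective := fun s t h =>
    hφ_mono.injective (PositiveQF.expI_injOn (hφ_mem s) (hφ_mem t) h)
  -- Here `l` is the order to which moments agree; writing `n` through it removes truncated
  -- subtraction.
  obtain ⟨l, rfl⟩ : ∃ l, n = l + m + 1 := ⟨n - m - 1, by omega⟩
  have e1 : l + m + 1 - 1 = l + m := by omega
  have e3 : l + m + 1 - m = l + 1 := by omega
  have e4 : ((l + m + 1 : ℕ) : ℤ) - m - 1 = l := by push_cast; ring
  simp only [e1, e3, e4, Nat.add_sub_cancel]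
  tfae_have 1 → 2 := fun ⟨_, hμ, h⟩ =>
    PositiveQF.exists_szegoRec_of_quadrature hσ_conc hfin hσ_supp hφ hμ h
  tfae_have 2 → 1 := fun ⟨_, _, ha, har, hη, hW⟩ =>
    PositiveQF.exists_quadrature_of_szegoRec hσ_conc hσ_mass hσ_supp ha har hη hW
  tfae_have 2 → 3 := fun ⟨_, _, ha, har, hη, hW⟩ =>
    PositiveQF.exists_factor_of_szegoRec hσ_conc hfin hσ_supp ha har hη hW
  tfae_have 3 → 2 := fun ⟨_, _, hq, hd, hz, hη, hW⟩ =>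
    PositiveQF.exists_szegoRec_of_factor hσ_conc hfin hσ_supp hq hd hz hη hW
  tfae_have 1 → 4 := by
    rintro ⟨μ, hμ, h⟩
    obtain ⟨h1, h2⟩ := (PositiveQF.moments_eq_iff_pos hσ_mass φ μ l).1 h
    obtain ⟨hm, hd⟩ := PositiveQF.weightedSum_monic_natDegree (φ := φ) h1
    have hW := PositiveQF.X_mul_weightedSum_add_star (φ := φ) h1
    refine ⟨_, _, hm, hd, PositiveQF.zerosInDisc_weightedSum hφ hμ h1,
      PositiveQF.norm_prod_neg_expI φ, hW, ?_⟩
    simpa only [eval_mul, eval_C] using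
      (PositiveQF.caratheodory_isBigO_iff h1 rfl hW (fun k => PositiveQF.moment σ k) l).2 h2
  tfae_have 4 → 1 := by
    rintro ⟨p, η, hm, hd, hz, hη, hW, hO⟩
    obtain ⟨μ, hμ, h1, hp⟩ := PositiveQF.exists_eq_weightedSum hφ hm hd hz hη hW
    refine ⟨μ, hμ, (PositiveQF.moments_eq_iff_pos hσ_mass φ μ l).2 ⟨h1, ?_⟩⟩
    refine (PositiveQF.caratheodory_isBigO_iff h1 hp hW (fun k => PositiveQF.moment σ k) l).1 ?_
    simpa only [eval_mul, eval_C] using hO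
  tfae_finish
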